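/- Throughout, $\log x$ means $\max\{1,\log_2 x\}$, $n=2^{2^k}$ with $k\ge 0$, and $p$, $q$ are powers of two. **Model.** A machine $M(q)$ has $q$ processing elements with unbounded local memories. A static algorithm is a sequence of supersteps with labels, fixed for each input size. In an $i$-superstep ($0\le i<\log_2 q$) each processing element computes locally and sends constant-size messages, to be received at the end of the superstep, only to processing elements whose index shares with its own the $i$ most significant bits. Folding on $q'<q$ processing elements lets the $j$-th one carry out the operations of the $q/q'$ consecutive ones starting at index $jq/q'$; supersteps with label $i\ge\log_2 q'$ become local computation. For an algorithm $\mathcal A$ executed (after folding, if necessary) on $p$ processors, let $F^i_{\mathcal A}(n,p)$ be the sum over its $i$-supersteps of the maximum number of messages sent or received by a processor, to or from other processors, and let $S^i_{\mathcal A}(n)$ be the number of its $i$-supersteps. The communication complexity on $M(p,\sigma)$ is $H_{\mathcal A}(n,p,\sigma)=\sum_{0\le i<\log_2 p}\left(F^i_{\mathcal A}(n,p)+S^i_{\mathcal A}(n)\,\sigma\right)$. For $0<\alpha\le1$, $\mathcal A$ is $(\alpha,p)$-wise if $\sum_{i<j}F^i_{\mathcal A}(n,2^j)\ge\alpha\frac{p}{2^j}\sum_{i<j}F^i_{\mathcal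 A}(n,p)$ for all $1\le j\le\log_2 p$ and all $n$. **Problem and class.** The $n$-input FFT DAG has the nodes $\langle w,l\rangle$, $0\le w<n$, $0\le l\le\log_2 n$, and an arc from $\langle w,l\rangle$ to $\langle w',l+1\rangle$ whenever $w'=w$ or $w'$ differs from $w$ exactly in the $l$-th bit; the nodes with $l=0$ are the inputs. For constants $\kappa\ge1$ and $\frac12\le\epsilon<1$ let $\mathscr C$ be the class of static algorithms that evaluate this DAG (messages carry at most $\kappa$ node values each; a node is evaluated where all its predecessors' values are available) such that, for $q$ processing elements, (i) each non-input node is evaluated exactly once; (ii) each input is initially held by exactly one processing element; (iii) no processing element evaluates more than $\epsilon n\log_2 n$ nodes; (iv) all foldings on $q'$ processing elements, $2\le q'<q$, also satisfy these conditions. The initial and final placement of the data is otherwise arbitrary. **Algorithm.** The network-oblivious FFT algorithm is specified on $M(n)$, with input $r$ in virtual processor $\mathrm{VP}_r$. If $n=2$, the two processors exchange their values and each evaluates one node. Otherwise, each of the $\sqrt n$ segments of $\sqrt n$ consecutive processors recursively computes, in parallel, a $\sqrt n$-input subDAG (the first $\frac12\log_2 n$ arc levels of the DAG); in a $0$-superstep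 the outputs are permuted by the transposition of a $\sqrt n\times\sqrt n$ matrix; then each segment recursively computes a $\sqrt n$-input subDAG of the remaining levels. The subproblems of size $m=n^{1/2^i}$ at recursion level $i$ use supersteps with label $(1-1/2^i)\log_2 n=\log_2 n-\log_2 m$, and in each superstep with this label $\mathrm{VP}_j$ also sends a dummy message to $\mathrm{VP}_{j+m/2}$, for $0\le j<m/2$. **Theorem.** The communication complexity of this algorithm is $$H_{\mathrm{FFT}}(n,p,\sigma)=O\!\left(\left(\frac np+\sigma\right)\frac{\log n}{\log(n/p)}\right)$$ for every $1<p\le n$ and $\sigma\ge0$, with an absolute implied constant. The algorithm is $(\alpha,n)$-wise for a constant $\alpha\in(0,1]$. It is $\Theta(1)$-optimal with respect to $\mathscr C$ on any $M(p,\sigma)$ with $1<p\le n$ and $\sigma=O(n/p)$: for all constants $\frac12\le\epsilon<1$, $\kappa\ge1$ and $c\ge0$ there is a $\beta\in(0,1]$ such that, for all such $n$, $p$ and all $0\le\sigma\le c\,n/p$, the algorithm (folded on $p$ processors) belongs to $\mathscr C$, and every algorithm $\mathcal B'\in\mathscr C$ for $p$ processors satisfies $H_{\mathrm{FFT}}(n,p,\sigma)\le\frac1\beta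 H_{\mathcal B'}(n,p,\sigma)$. -/

import Mathlib

/-! ## Static DAG algorithms on the machine with `2 ^ d` processing elements -/

/-- A message from `src` to `dst`. Its payload is the (constant-size) set of DAG-node values that it
carries; a dummy message has an empty payload. -/
structure Message (V : Type) (d : ℕ) where
  src : Fin (2 ^ d)
  dst : Fin (2 ^ d)
  payload : Finset V

/-- A superstep of a static DAG algorithm: its label, the DAG nodes evaluated by every processing
element (with multiplicity), and the messages sent, which are delivered at the closing barrier.
A label `i ≥ d` denotes a phase of purely local computation: no communication between distinct
processing elements is possible in it, and it is not charged. -/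
structure Superstep (V : Type) (d : ℕ) where
  label : ℕ
  comp : Fin (2 ^ d) → Multiset V
  msgs : Multiset (Message V d)

/-- A static DAG algorithm (for one input size) on `2 ^ d` processing elements: the initial
placement of the input values (with multiplicity) and the sequence of supersteps. Nothing in it
depends on the input instance. -/
structure StaticAlg (V : Type) (d : ℕ) where
  init : Fin (2 ^ d) → Multiset V
  steps : List (Superstep V d)

/-- `r` and `r'` share the `i` most significant of their `d` bits (for `i ≥ d`: `r = r'`). -/
def SameCluster {d : ℕ} (i : ℕ) (r r' : Fin (2 ^ d)) : Prop :=
  (r : ℕ) / 2 ^ (d - i) = (r' : ℕ) / 2 ^ (d - i)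

/-- A node of indegree zero. -/
def IsInputNode {V : Type} (G : Digraph V) (v : V) : Prop := ∀ u, ¬ G.Adj u v

namespace Superstep

variable {V : Type} {d : ℕ}

/-- The superstep can be executed when `M r` is the set of node values in the local memory of `r`.
A processing element may evaluate in one superstep nodes that depend on each other (in an order
compatible with the arcs), and may send any value it holds or has just evaluated. -/
def Legal (G : Digraph V) (M : Fin (2 ^ d) → Set V) (s : Superstep V d) : Prop :=
  (∀ r, ∀ v ∈ s.comp r, ¬ IsInputNode G v ∧ ∀ u, G.Adj u v → u ∈ M r ∨ u ∈ s.comp r) ∧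
  (∀ m ∈ s.msgs, SameCluster s.label m.src m.dst ∧
    ∀ v ∈ m.payload, v ∈ M m.src ∨ v ∈ s.comp m.src)

/-- The contents of the local memories after the superstep. -/
def next (M : Fin (2 ^ d) → Set V) (s : Superstep V d) : Fin (2 ^ d) → Set V :=
  fun r => {v | v ∈ M r ∨ v ∈ s.comp r ∨ ∃ m ∈ s.msgs, m.dst = r ∧ v ∈ m.payload}

/-- The number of messages sent by `r` to other processing elements. -/
def sent (s : Superstep V d) (r : Fin (2 ^ d)) : ℕ :=
  (s.msgs.filter (fun m => m.src = r ∧ m.dst ≠ r)).card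

/-- The number of messages destined to `r` by other processing elements. -/
def received (s : Superstep V d) (r : Fin (2 ^ d)) : ℕ :=
  (s.msgs.filter (fun m => m.dst = r ∧ m.src ≠ r)).card

/-- The degree `h` of the relation realised by the messages of the superstep. -/
def degree (s : Superstep V d) : ℕ :=
  Finset.univ.sup (fun r => max (s.sent r) (s.received r))

end Superstep

/-- The processing element, among `2 ^ e` ones, that carries out the operations of the `r`-th of
`2 ^ d` processing elements (`e ≤ d`; then `r / 2 ^ (d - e) < 2 ^ e`, so nothing is reduced). -/
def foldPE {d : ℕ} (e : ℕ) (r : Fin (2 ^ d)) : Fin (2 ^ e) :=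
  Fin.ofNat (2 ^ e) ((r : ℕ) / 2 ^ (d - e))

namespace StaticAlg

variable {V : Type} {d : ℕ}

/-- All supersteps of the list can be executed in sequence, from local memories `M`. -/
def LegalRun (G : Digraph V) : (Fin (2 ^ d) → Set V) → List (Superstep V d) → Prop
  | _, [] => True
  | M, s :: ss => s.Legal G M ∧ LegalRun G (s.next M) ss

/-- Only input values are initially present, and the execution respects the arcs of the DAG and the
labels of the supersteps. -/
def Valid (G : Digraph V) (B : StaticAlg V d) : Prop :=
  (∀ r, ∀ v ∈ B.init r, IsInputNode G v) ∧ LegalRun G (fun r => {v | v ∈ B.init r}) B.steps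

/-- The number of initial copies of the value of `v`. -/
def initCount [DecidableEq V] (B : StaticAlg V d) (v : V) : ℕ := ∑ r, (B.init r).count v

/-- The number of times that `v` is evaluated during the algorithm. -/
def evalCount [DecidableEq V] (B : StaticAlg V d) (v : V) : ℕ :=
  (B.steps.map (fun s => ∑ r, (s.comp r).count v)).sum

/-- The number of node evaluations performed by `r`. -/
def work (B : StaticAlg V d) (r : Fin (2 ^ d)) : ℕ :=
  (B.steps.map (fun s => (s.comp r).card)).sum

/-- Folding on `2 ^ e` processing elements (`e ≤ d`). Labels are kept, so supersteps with label
`≥ e` become local computation; messages inside a processing element become local as well. -/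
def fold (e : ℕ) (B : StaticAlg V d) : StaticAlg V e where
  init j := ∑ r with foldPE e r = j, B.init r
  steps := B.steps.map fun s =>
    { label := s.label
      comp := fun j => ∑ r with foldPE e r = j, s.comp r
      msgs := s.msgs.map fun m => ⟨foldPE e m.src, foldPE e m.dst, m.payload⟩ }

/-- `S^i`: the number of `i`-supersteps. -/
def S (B : StaticAlg V d) (i : ℕ) : ℕ := (B.steps.filter (fun s => s.label = i)).length

/-- `F^i`: the cumulative degree of the `i`-supersteps. -/
def F (B : StaticAlg V d) (i : ℕ) : ℕ :=
  ((B.steps.filter (fun s => s.label = i)).map Superstep.degree).sum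

/-- The communication complexity of an algorithm for `2 ^ d` processors on the evaluation model
`M(2 ^ d, σ)`. -/
noncomputable def commComplexity (B : StaticAlg V d) (σ : ℝ) : ℝ :=
  ∑ i ∈ Finset.range d, ((B.F i : ℝ) + (B.S i : ℝ) * σ)

/-- `(α, 2 ^ e)`-wiseness (for this input size) of an algorithm specified on `2 ^ d` processing
elements. -/
def IsWise (α : ℝ) (e : ℕ) (B : StaticAlg V d) : Prop :=
  ∀ j, 1 ≤ j → j ≤ e →
    α * ((2 : ℝ) ^ e / 2 ^ j) * ∑ i ∈ Finset.range j, ((B.fold e).F i : ℝ)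
      ≤ ∑ i ∈ Finset.range j, ((B.fold j).F i : ℝ)

/-- `β`-optimality of `B` on `M(2 ^ d, σ)` with respect to a class (for this input size). -/
def IsOptimal (β σ : ℝ) (𝒞 : Set (StaticAlg V d)) (B : StaticAlg V d) : Prop :=
  B ∈ 𝒞 ∧ ∀ B' ∈ 𝒞, B.commComplexity σ ≤ 1 / β * B'.commComplexity σ

end StaticAlg

/-! ## The FFT DAG and the class of algorithms -/

/-- Nodes `⟨w, l⟩` of the FFT DAG with `2 ^ a` inputs: `0 ≤ w < 2 ^ a` and `0 ≤ l ≤ a`. -/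
abbrev FFTNode (a : ℕ) : Type := Fin (2 ^ a) × Fin (a + 1)

/-- The FFT DAG with `2 ^ a` inputs: arcs lead from `⟨w, l⟩` to `⟨w', l + 1⟩`, where `w' = w` or
`w'` differs from `w` exactly in the `l`-th bit. -/
def fftDAG (a : ℕ) : Digraph (FFTNode a) where
  Adj u v := (v.2 : ℕ) = (u.2 : ℕ) + 1 ∧
    (v.1 = u.1 ∨ (v.1 : ℕ) = (u.1 : ℕ) ^^^ 2 ^ (u.2 : ℕ))

/-- The defining properties, apart from the closure under folding, of the class of algorithms for
the FFT DAG with `n = 2 ^ a` inputs on `2 ^ d` processing elements. -/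
structure IsFFTAlg (ε : ℝ) (κ : ℕ) {a d : ℕ} (B : StaticAlg (FFTNode a) d) : Prop where
  valid : B.Valid (fftDAG a)
  /-- messages have constant size -/
  message_size : ∀ s ∈ B.steps, ∀ m ∈ s.msgs, m.payload.card ≤ κ
  /-- all operations are executed, and none is executed twice -/
  eval_once : ∀ v, ¬ IsInputNode (fftDAG a) v → B.evalCount v = 1
  /-- every input is present, and none is initially replicated -/
  input_once : ∀ v, IsInputNode (fftDAG a) v → B.initCount v = 1
  /-- no processing element evaluates more than `ε n log n` nodes -/
  balanced : ∀ r, (B.work r : ℝ) ≤ ε * (2 ^ a * a)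

/-- The class `𝒞` for `n = 2 ^ a` and `2 ^ d` processing elements: all foldings on at least two
processing elements satisfy the defining properties as well. -/
def FFTClass (ε : ℝ) (κ a d : ℕ) : Set (StaticAlg (FFTNode a) d) :=
  {B | IsFFTAlg ε κ B ∧ ∀ e, 1 ≤ e → e < d → IsFFTAlg ε κ (B.fold e)}

/-! ## The recursive network-oblivious FFT algorithm

All segments of the same size work in parallel. At a given moment every virtual processor `r` holds
the value of the node `⟨col r, l⟩`, where `l` is the current level and `col` the current arrangement
of the columns of the DAG. -/

namespace RecFFT

variable {a : ℕ}

/-- The virtual processor with index `x`. -/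
def vp (x : ℕ) : Fin (2 ^ a) := Fin.ofNat (2 ^ a) x

/-- The node in column `w` at level `l`. -/
def node (w : Fin (2 ^ a)) (l : ℕ) : FFTNode a := (w, Fin.ofNat (a + 1) l)

/-- The dummy messages of the supersteps with label `a - log m`: for `0 ≤ j < m / 2`, processor `j`
sends one to processor `j + m / 2`. -/
def dummies (m : ℕ) : Multiset (Message (FFTNode a) a) :=
  (Multiset.range (m / 2)).map fun j => ⟨vp j, vp (j + m / 2), ∅⟩

/-- In every segment of `m * m` virtual processors, the transposition of an `m × m` matrix. -/
def transpose (m : ℕ) (r : Fin (2 ^ a)) : Fin (2 ^ a) :=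
  vp ((r : ℕ) / (m * m) * (m * m) + (r : ℕ) % m * m + (r : ℕ) / m % m)

/-- Every virtual processor sends the value of its current node to the partner given by `f`, within
the segments of `2 ^ b` processors; the dummy messages are added. -/
def commStep (b l : ℕ) (col f : Fin (2 ^ a) → Fin (2 ^ a)) : Superstep (FFTNode a) a where
  label := a - b
  comp := fun _ => 0
  msgs := (Finset.univ.val.map fun r => ⟨r, f r, {node (col r) l}⟩) + dummies (2 ^ b)

/-- Every virtual processor evaluates the next node of its column. -/
def compStep (l : ℕ) (col : Fin (2 ^ a) → Fin (2 ^ a)) : Superstep (FFTNode a) a where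
  label := a - 1
  comp := fun r => {node (col r) (l + 1)}
  msgs := dummies 2

/-- The arrangement of the columns after the segments of `2 ^ 2 ^ k` processors have computed their
subDAGs. -/
def arrange : (k : ℕ) → (Fin (2 ^ a) → Fin (2 ^ a)) → Fin (2 ^ a) → Fin (2 ^ a)
  | 0, col => col
  | k + 1, col => arrange k (arrange k col ∘ transpose (2 ^ 2 ^ k))

/-- In parallel, every segment of `m = 2 ^ 2 ^ k` processors computes the assigned `m`-input
subDAG, which spans the levels `l, …, l + 2 ^ k`. For `m = 2`, the two processors exchange their
values and evaluate one node each. Otherwise the first set of `√m`-input subDAGs is computed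
recursively, the outputs are transposed, and the second set is computed recursively. -/
def steps : (k l : ℕ) → (Fin (2 ^ a) → Fin (2 ^ a)) → List (Superstep (FFTNode a) a)
  | 0, l, col => [commStep 1 l col fun r => vp ((r : ℕ) ^^^ 1), compStep l col]
  | k + 1, l, col =>
      steps k l col ++
      commStep (2 ^ (k + 1)) (l + 2 ^ k) (arrange k col) (transpose (2 ^ 2 ^ k)) ::
      steps k (l + 2 ^ k) (arrange k col ∘ transpose (2 ^ 2 ^ k))

/-- The algorithm for `n = 2 ^ 2 ^ k` inputs on `n` virtual processors, the `r`-th of which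
initially holds the `r`-th input. -/
def alg (k : ℕ) : StaticAlg (FFTNode (2 ^ k)) (2 ^ k) where
  init := fun r => {node r 0}
  steps := steps k 0 id

end RecFFT

/-- `log x` stands for `max {1, log₂ x}`. -/
noncomputable def plog (x : ℝ) : ℝ := max 1 (Real.logb 2 x)

/-! The upper bound is a count. On `p` processors a superstep on segments of size `m` is charged
only if `m > n/p`. Two recursive calls joined by one transposition turn a number `x` of charged
supersteps into `2x + 1` each time `log m` doubles, so `O(log n / log(n/p))` supersteps are charged
(`charged_steps_le`). In each of them a virtual processor sends and receives at most two messages,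
so the folded degree is at most `2n/p`. Conversely, the dummy messages force a degree of at least
`n/p` in every charged superstep, which gives wiseness with `α = 1/2`.

The substance is the matching lower bound `H = Ω((n/p) log n / log(n/p))` for every algorithm of the
class. Time is the accumulated degree of the supersteps, so in `t` units a processor sends at most
`κ t` values. Two facts about the DAG are used: a node set with `x` boundary nodes has at most `x (1
+ log₂ x)` nodes (`card_le_xlog_outNodes`), and the frontier of a predecessor-closed set has at most
`2n` nodes (`card_outNodes_le_of_closed`).

The history of each processor is cut into phases (`card_window_le`). A phase of length `j` evaluates
at most as many nodes as a boundary of size `2κj` permits, which is `O(log(n/p))` per time unit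
while `j` is of order `n/p`. A phase gets longer only while the processor holds many live values;
since at most `2n` values are live at any time, long phases are affordable on average. Summing over
the processors bounds `n log n` by `O(p H log(n/p))`, apart from the last phases, whose boundary
consists of outputs.

That last term is harmless if no processor owns more than about `n^(1/8)` nodes
(`le_time_of_part_le`). If one does, balance is used instead: a part with at most a fraction `ε < 1`
of the non-input nodes has a boundary of order at least its size divided by `log n`, because the
`n²` input-output paths pass evenly through the nodes (`card_le_of_balanced`). The same argument
settles the case where `log n` and `log(n/p)` are comparable. -/

/-! ## Boundaries of node sets of the FFT DAG -/

section Boundary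

variable {a : ℕ}

/-- The column that differs from `w` exactly in bit `l`. -/
def flipCol (w : Fin (2 ^ a)) (l : ℕ) : Fin (2 ^ a) := Fin.ofNat (2 ^ a) ((w : ℕ) ^^^ 2 ^ l)

theorem flipCol_val {l : ℕ} (hl : l < a) (w : Fin (2 ^ a)) :
    (flipCol w l : ℕ) = (w : ℕ) ^^^ 2 ^ l := by
  simp only [flipCol, Fin.ofNat]
  exact Nat.mod_eq_of_lt (Nat.xor_lt_two_pow w.isLt (Nat.pow_lt_pow_right (by norm_num) hl))

theorem flipCol_flipCol {l : ℕ} (hl : l < a) (w : Fin (2 ^ a)) :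
    flipCol (flipCol w l) l = w := by
  apply Fin.ext
  rw [flipCol_val hl, flipCol_val hl, Nat.xor_assoc, Nat.xor_self, Nat.xor_zero]

theorem flipCol_injective {l : ℕ} (hl : l < a) :
    Function.Injective fun w : Fin (2 ^ a) => flipCol w l := fun w w' h => by
  have := congrArg (fun x => flipCol x l) h
  simpa [flipCol_flipCol hl] using this

theorem flipCol_testBit {l : ℕ} (hl : l < a) (w : Fin (2 ^ a)) (j : ℕ) :
    (flipCol w l : ℕ).testBit j = ((w : ℕ).testBit j ^^ decide (l = j)) := by
  rw [flipCol_val hl, Nat.testBit_xor, Nat.testBit_two_pow]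

theorem adj_iff (u v : FFTNode a) : (fftDAG a).Adj u v ↔
    (v.2 : ℕ) = (u.2 : ℕ) + 1 ∧ (v.1 = u.1 ∨ v.1 = flipCol u.1 u.2) := by
  simp only [fftDAG]
  refine and_congr_right fun h => or_congr_right ?_
  have hl : (u.2 : ℕ) < a := by have := v.2.isLt; omega
  rw [Fin.ext_iff, flipCol_val hl]

theorem adj_straight {w : Fin (2 ^ a)} {l l' : Fin (a + 1)} (h : (l' : ℕ) = l + 1) :
    (fftDAG a).Adj (w, l) (w, l') := (adj_iff _ _).2 ⟨h, Or.inl rfl⟩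

theorem adj_flip {w : Fin (2 ^ a)} {l l' : Fin (a + 1)} (h : (l' : ℕ) = l + 1) :
    (fftDAG a).Adj (w, l) (flipCol w l, l') := (adj_iff _ _).2 ⟨h, Or.inr rfl⟩

theorem isInputNode_iff (v : FFTNode a) : IsInputNode (fftDAG a) v ↔ (v.2 : ℕ) = 0 := by
  constructor
  · intro h
    by_contra h0
    obtain ⟨w, l⟩ := v
    have hl := l.isLt
    have h0 : (l : ℕ) ≠ 0 := h0
    exact h (w, ⟨l - 1, by omega⟩) (adj_straight (show (l : ℕ) = l - 1 + 1 by omega))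
  · intro h u hu
    have := ((adj_iff _ _).1 hu).1
    omega

open Classical in
/-- The nodes of `E` that are outputs of the DAG or have a successor outside `E`. -/
noncomputable def outNodes (E : Finset (FFTNode a)) : Finset (FFTNode a) :=
  E.filter fun v => (v.2 : ℕ) = a ∨ ∃ u, (fftDAG a).Adj v u ∧ u ∉ E

theorem mem_outNodes {E : Finset (FFTNode a)} {v : FFTNode a} :
    v ∈ outNodes E ↔ v ∈ E ∧ ((v.2 : ℕ) = a ∨ ∃ u, (fftDAG a).Adj v u ∧ u ∉ E) := by
  simp [outNodes]

theorem exists_outNode_above (E : Finset (FFTNode a)) {v : FFTNode a} (hv : v ∈ E) :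
    ∃ u ∈ outNodes E, u.1 = v.1 := by
  induction hs : a - (v.2 : ℕ) generalizing v with
  | zero =>
    refine ⟨v, mem_outNodes.2 ⟨hv, Or.inl ?_⟩, rfl⟩
    have := v.2.isLt
    omega
  | succ s ih =>
    have h1 : (v.2 : ℕ) + 1 < a + 1 := by omega
    by_cases hn : (v.1, (⟨v.2 + 1, h1⟩ : Fin (a + 1))) ∈ E
    · obtain ⟨u, hu, hc⟩ := ih hn (by simp; omega)
      exact ⟨u, hu, hc⟩
    · exact ⟨v, mem_outNodes.2 ⟨hv, Or.inr ⟨_, adj_straight (w := v.1) (l := v.2) rfl, hn⟩⟩, rfl⟩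

/-- Climbing the column of a node inside `E` ends at an out-boundary node of that column, and nodes
of one level lie in different columns. -/
theorem card_level_le_outNodes (E : Finset (FFTNode a)) (l : ℕ) :
    (E.filter fun v => (v.2 : ℕ) = l).card ≤ (outNodes E).card := by
  classical
  apply Finset.card_le_card_of_forall_subsingleton (fun v u => u.1 = v.1)
  · intro v hv
    exact exists_outNode_above E (Finset.mem_filter.1 hv).1
  · rintro u - v ⟨hv, hvu⟩ v' ⟨hv', hvu'⟩
    have hv := (Finset.mem_filter.1 hv).2
    have hv' := (Finset.mem_filter.1 hv').2
    exact Prod.ext (hvu.symm.trans hvu') (Fin.ext (hv.trans hv'.symm))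

/-- The bound `x (1 + log₂ x)` on the size of a node set with out-boundary `x`. -/
noncomputable def xlog (x : ℝ) : ℝ := x * (1 + Real.logb 2 x)

theorem self_le_xlog (z : ℕ) : (z : ℝ) ≤ xlog z := by
  rcases Nat.eq_zero_or_pos z with rfl | hz
  · simp [xlog]
  · have : 0 ≤ Real.logb 2 (z : ℝ) := Real.logb_nonneg (by norm_num) (by exact_mod_cast hz)
    have hz' : (0 : ℝ) ≤ z := by positivity
    unfold xlog
    nlinarith

theorem xlog_mono {x y : ℕ} (h : x ≤ y) : xlog x ≤ xlog y := by
  rcases Nat.eq_zero_or_pos x with rfl | hx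
  · have := self_le_xlog y
    have h0 : (0 : ℝ) ≤ y := by positivity
    simp [xlog] at *
    linarith
  · have hx1 : (1 : ℝ) ≤ x := by exact_mod_cast hx
    have hxy : (x : ℝ) ≤ y := by exact_mod_cast h
    have h1 : Real.logb 2 (x : ℝ) ≤ Real.logb 2 y :=
      Real.logb_le_logb_of_le (by norm_num) (by linarith) hxy
    have h0 : 0 ≤ Real.logb 2 (x : ℝ) := Real.logb_nonneg (by norm_num) hx1
    unfold xlog
    exact mul_le_mul hxy (by linarith) (by linarith) (by linarith)

/-- Accounts for the `z` nodes of a removed level that are themselves boundary nodes. -/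
theorem xlog_add_le (s z : ℕ) : xlog s + z ≤ xlog ((s + z : ℕ) : ℝ) := by
  rcases Nat.eq_zero_or_pos s with rfl | hs
  · have := self_le_xlog z
    simpa [xlog] using this
  · have hs1 : (1 : ℝ) ≤ s := by exact_mod_cast hs
    have hz : (0 : ℝ) ≤ z := by positivity
    have h1 : Real.logb 2 (s : ℝ) ≤ Real.logb 2 (s + z) :=
      Real.logb_le_logb_of_le (by norm_num) (by linarith) (by linarith)
    have h0 : 0 ≤ Real.logb 2 (s : ℝ) := Real.logb_nonneg (by norm_num) hs1
    unfold xlog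
    push_cast
    nlinarith

/-- Bernoulli's inequality in the form `2^t ≤ 1 + t` on `[0, 1]`. -/
theorem le_logb_one_add {t : ℝ} (h0 : 0 ≤ t) (h1 : t ≤ 1) : t ≤ Real.logb 2 (1 + t) := by
  rw [Real.le_logb_iff_rpow_le (by norm_num) (by linarith)]
  have := rpow_one_add_le_one_add_mul_self (s := 1) (by norm_num) h0 h1
  norm_num at this
  linarith

/-- Merging gains `x` twice: the logarithm of the smaller term grows by at least `1` because `x + y
≥ 2x`, and that of the larger one by at least `x / y`. The gain `2x` pays for the interior nodes of
one level. -/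
theorem xlog_add_xlog_le {x y : ℕ} (h : x ≤ y) :
    xlog x + xlog y + 2 * x ≤ xlog ((x + y : ℕ) : ℝ) := by
  rcases Nat.eq_zero_or_pos x with rfl | hx
  · simp [xlog]
  · have hx1 : (1 : ℝ) ≤ x := by exact_mod_cast hx
    have hxy : (x : ℝ) ≤ y := by exact_mod_cast h
    have hy0 : (0 : ℝ) < y := by linarith
    have h1 : 1 + Real.logb 2 (x : ℝ) ≤ Real.logb 2 (x + y) := by
      have : Real.logb 2 (2 * x : ℝ) = 1 + Real.logb 2 x := by
        rw [Real.logb_mul (by norm_num) (by linarith), Real.logb_self_eq_one (by norm_num)]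
      rw [← this]
      exact Real.logb_le_logb_of_le (by norm_num) (by linarith) (by linarith)
    have h2 : (x : ℝ) / y + Real.logb 2 y ≤ Real.logb 2 (x + y) := by
      have := le_logb_one_add (t := (x : ℝ) / y) (by positivity)
        ((div_le_one hy0).2 hxy)
      have h3 : ((x : ℝ) + y) = (1 + x / y) * y := by field_simp; ring
      rw [h3, Real.logb_mul (by positivity) (by linarith)]
      linarith
    have h4 : (y : ℝ) * (x / y + Real.logb 2 y) ≤ y * Real.logb 2 (x + y) :=
      mul_le_mul_of_nonneg_left h2 hy0.le
    have h5 : (y : ℝ) * (x / y + Real.logb 2 y) = x + y * Real.logb 2 y := by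
      field_simp
    unfold xlog
    push_cast
    nlinarith

/-- Induction on the number of levels, counted from the outputs: without its lowest level, the DAG
falls apart into two halves. -/
theorem card_le_xlog_of_level (s : ℕ) : ∀ E : Finset (FFTNode a),
    (∀ v ∈ E, a ≤ (v.2 : ℕ) + s) → (E.card : ℝ) ≤ xlog (outNodes E).card := by
  classical
  induction s with
  | zero =>
    intro E hE
    have : outNodes E = E := by
      apply Finset.filter_true_of_mem
      intro v hv
      have := hE v hv
      have := v.2.isLt
      left; omega
    rw [this]
    exact self_le_xlog _
  | succ s ih =>
    intro E hE
    -- If `s + 1` exceeds `a`, there is no level to remove and the induction hypothesis already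
    -- covers `E`.
    by_cases hsa : a < s + 1
    · apply ih E
      intro v hv
      have := hE v hv
      omega
    set l := a - (s + 1) with hl
    have hla : l < a := by omega
    -- Arcs that start above level `l` never change bit `l` of the column, so no arc joins the two
    -- halves.
    let Eb : Bool → Finset (FFTNode a) := fun b =>
      E.filter fun v => l < (v.2 : ℕ) ∧ (v.1 : ℕ).testBit l = b
    let E0 : Finset (FFTNode a) := E.filter fun v => (v.2 : ℕ) = l
    have hsucc : ∀ b, ∀ v ∈ Eb b, ∀ u, (fftDAG a).Adj v u → u ∈ E → u ∈ Eb b := by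
      intro b v hv u hvu hu
      simp only [Eb, Finset.mem_filter] at hv ⊢
      obtain ⟨h1, h2⟩ := (adj_iff _ _).1 hvu
      have hva : (v.2 : ℕ) < a := by have := u.2.isLt; omega
      refine ⟨hu, by omega, ?_⟩
      rcases h2 with h2 | h2
      · rw [h2]; exact hv.2.2
      · rw [h2, flipCol_testBit hva, hv.2.2, decide_eq_false (by omega),
          Bool.xor_false]
    have hout : ∀ b, outNodes (Eb b) ⊆ (outNodes E).filter fun v =>
        l < (v.2 : ℕ) ∧ (v.1 : ℕ).testBit l = b := by
      intro b v hv
      obtain ⟨hvb, hv2⟩ := mem_outNodes.1 hv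
      have hvb' := Finset.mem_filter.1 hvb
      refine Finset.mem_filter.2 ⟨mem_outNodes.2 ⟨hvb'.1, ?_⟩, hvb'.2⟩
      rcases hv2 with h | ⟨u, hvu, hu⟩
      · exact Or.inl h
      · exact Or.inr ⟨u, hvu, fun hE => hu (hsucc b v hvb u hvu hE)⟩
    -- The lowest level consists of boundary nodes (`Z`) and of nodes with both successors in `E`
    -- (`N`).
    let Z := (outNodes E).filter fun v => (v.2 : ℕ) = l
    let N := E0.filter fun v => v ∉ outNodes E
    have hoc : (outNodes (Eb false)).card + (outNodes (Eb true)).card + Z.card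
        ≤ (outNodes E).card := by
      calc _ ≤ ((outNodes E).filter fun v => l < (v.2 : ℕ) ∧ (v.1 : ℕ).testBit l = false).card +
            ((outNodes E).filter fun v => l < (v.2 : ℕ) ∧ (v.1 : ℕ).testBit l = true).card
              + Z.card := by
            gcongr
            · exact hout false
            · exact hout true
        _ ≤ _ := by
          rw [← Finset.card_union_of_disjoint, ← Finset.card_union_of_disjoint]
          · apply Finset.card_le_card
            intro v hv
            simp only [Finset.mem_union, Finset.mem_filter, Z] at hv
            tauto
          · rw [Finset.disjoint_left]
            intro v hv hv'
            simp only [Finset.mem_union, Finset.mem_filter, Z] at hv hv'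
            omega
          · rw [Finset.disjoint_left]
            intro v hv hv'
            simp only [Finset.mem_filter] at hv hv'
            rw [hv.2.2] at hv'
            simp at hv'
    have hEc : E.card ≤ (Eb false).card + (Eb true).card + Z.card + N.card := by
      have : E ⊆ Eb false ∪ Eb true ∪ Z ∪ N := by
        intro v hv
        have h1 := hE v hv
        simp only [Finset.mem_union, Finset.mem_filter, Z, N, E0, Eb]
        by_cases h : l < (v.2 : ℕ)
        · cases hb : (v.1 : ℕ).testBit l <;> tauto
        · have : (v.2 : ℕ) = l := by omega
          tauto
      refine (Finset.card_le_card this).trans ?_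
      refine (Finset.card_union_le _ _).trans (Nat.add_le_add_right ?_ _)
      refine (Finset.card_union_le _ _).trans (Nat.add_le_add_right ?_ _)
      exact Finset.card_union_le _ _
    -- Each node of `N` has exactly one successor in the half `c`, and a node of level `l + 1` has
    -- two predecessors. The bound holds for either half, hence for the one with the smaller
    -- boundary.
    have hN : ∀ c, N.card ≤ 2 * (outNodes (Eb c)).card := by
      intro c
      have hl1 : l + 1 < a + 1 := by omega
      have key : ∀ v ∈ N, (v.1, (⟨l + 1, hl1⟩ : Fin (a + 1))) ∈ E ∧
          (flipCol v.1 l, (⟨l + 1, hl1⟩ : Fin (a + 1))) ∈ E := by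
        intro v hv
        simp only [N, E0, Finset.mem_filter, mem_outNodes] at hv
        obtain ⟨⟨hvE, hvl⟩, hv2⟩ := hv
        constructor
        · by_contra h
          exact hv2 ⟨hvE, Or.inr ⟨_, adj_straight (w := v.1) (l := v.2) (by simp [hvl]), h⟩⟩
        · by_contra h
          have := adj_flip (w := v.1) (l := v.2) (l' := ⟨l + 1, hl1⟩) (by simp [hvl])
          rw [hvl] at this
          exact hv2 ⟨hvE, Or.inr ⟨_, this, h⟩⟩
      have hlev := card_level_le_outNodes (Eb c) (l + 1)
      have h1 : (N.filter fun v => (v.1 : ℕ).testBit l = c).card ≤ (outNodes (Eb c)).card := by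
        refine le_trans (Finset.card_le_card_of_injOn
          (fun v => (v.1, (⟨l + 1, hl1⟩ : Fin (a + 1)))) ?_ ?_) hlev
        · intro v hv
          have hv := Finset.mem_filter.1 hv
          have := key v hv.1
          simp [Eb, this.1, hv.2]
        · intro v hv v' hv' h
          have hv := (Finset.mem_filter.1 (Finset.mem_filter.1 (Finset.mem_filter.1 hv).1).1).2
          have hv' := (Finset.mem_filter.1 (Finset.mem_filter.1 (Finset.mem_filter.1 hv').1).1).2
          simp only [Prod.mk.injEq, and_true] at h
          exact Prod.ext h (Fin.ext (hv.trans hv'.symm))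
      have h2 : (N.filter fun v => ¬ (v.1 : ℕ).testBit l = c).card ≤ (outNodes (Eb c)).card := by
        refine le_trans (Finset.card_le_card_of_injOn
          (fun v => (flipCol v.1 l, (⟨l + 1, hl1⟩ : Fin (a + 1)))) ?_ ?_) hlev
        · intro v hv
          have hv := Finset.mem_filter.1 hv
          have := key v hv.1
          have hb := hv.2
          simp only [Finset.coe_filter, Set.mem_ofPred_eq, Eb, Finset.mem_filter, this.2, true_and,
            and_true, flipCol_testBit hla]
          refine ⟨by omega, ?_⟩
          cases hc : (v.1 : ℕ).testBit l <;> cases c <;> simp_all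
        · intro v hv v' hv' h
          have hv := (Finset.mem_filter.1 (Finset.mem_filter.1 (Finset.mem_filter.1 hv).1).1).2
          have hv' := (Finset.mem_filter.1 (Finset.mem_filter.1 (Finset.mem_filter.1 hv').1).1).2
          simp only [Prod.mk.injEq, and_true] at h
          exact Prod.ext (flipCol_injective hla h) (Fin.ext (hv.trans hv'.symm))
      have := Finset.card_filter_add_card_filter_not (s := N) fun v => (v.1 : ℕ).testBit l = c
      omega
    have hi : ∀ b, ((Eb b).card : ℝ) ≤ xlog (outNodes (Eb b)).card := by
      intro b
      apply ih
      intro v hv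
      have := (Finset.mem_filter.1 hv).2.1
      omega
    have hsum : xlog (outNodes (Eb false)).card + xlog (outNodes (Eb true)).card + N.card ≤
        xlog (((outNodes (Eb false)).card + (outNodes (Eb true)).card : ℕ) : ℝ) := by
      rcases le_total (outNodes (Eb false)).card (outNodes (Eb true)).card with h | h
      · have h1 := xlog_add_xlog_le h
        have h2 : (N.card : ℝ) ≤ 2 * (outNodes (Eb false)).card := by exact_mod_cast hN false
        linarith
      · have h1 := xlog_add_xlog_le h
        have h2 : (N.card : ℝ) ≤ 2 * (outNodes (Eb true)).card := by exact_mod_cast hN true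
        rw [Nat.add_comm]
        linarith
    have h1 := xlog_add_le ((outNodes (Eb false)).card + (outNodes (Eb true)).card) Z.card
    have h2 := xlog_mono hoc
    have h3 := hi false
    have h4 := hi true
    have h5 : (E.card : ℝ) ≤ (Eb false).card + (Eb true).card + Z.card + N.card := by
      exact_mod_cast hEc
    linarith

/-- A node set of the FFT DAG with `x` boundary nodes has at most `x (1 + log₂ x)` nodes. -/
theorem card_le_xlog_outNodes (E : Finset (FFTNode a)) :
    (E.card : ℝ) ≤ xlog (outNodes E).card :=
  card_le_xlog_of_level a E fun _ _ => Nat.le_add_left _ _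

/-- The frontier of a set of nodes that is closed under predecessors has at most `2 n` nodes. -/
theorem card_outNodes_le_of_closed (D : Finset (FFTNode a))
    (hD : ∀ u v, (fftDAG a).Adj u v → v ∈ D → u ∈ D) :
    (outNodes D).card ≤ 2 * 2 ^ a := by
  classical
  let top : FFTNode a → Prop := fun v =>
    ∀ l : Fin (a + 1), (v.2 : ℕ) < l → (v.1, l) ∉ D
  have hdown : ∀ (w : Fin (2 ^ a)) (s : ℕ) (l l' : Fin (a + 1)), (l : ℕ) + s = l' →
      (w, l') ∈ D → (w, l) ∈ D := by
    intro w s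
    induction s with
    | zero =>
      intro l l' h h'
      have : l = l' := Fin.ext (by omega)
      rwa [this]
    | succ s ih =>
      intro l l' h h'
      have h1 : (l : ℕ) + 1 < a + 1 := by have := l'.isLt; omega
      exact hD _ _ (adj_straight (l' := ⟨l + 1, h1⟩) rfl) (ih ⟨l + 1, h1⟩ l' (by simp; omega) h')
  have htop_of : ∀ v : FFTNode a, ((v.2 : ℕ) = a ∨
      ∃ l : Fin (a + 1), (l : ℕ) = v.2 + 1 ∧ (v.1, l) ∉ D) → top v := by
    rintro v (h | ⟨l, hl, h⟩) l' hl' hD'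
    · have := l'.isLt; omega
    · exact h (hdown v.1 (l' - l) l l' (by omega) hD')
  let T := D.filter top
  have hT : T.card ≤ 2 ^ a := by
    have : T.card ≤ (Finset.univ : Finset (Fin (2 ^ a))).card := by
      apply Finset.card_le_card_of_injOn (fun v => v.1)
        (fun _ _ => Finset.mem_coe.2 (Finset.mem_univ _))
      rintro ⟨w, l⟩ hv ⟨w', l'⟩ hv' (h : w = w')
      subst h
      simp only [T, Finset.coe_filter, Set.mem_ofPred_eq, top] at hv hv'
      have h1 : ¬ (l : ℕ) < l' := fun h => hv.2 l' h hv'.1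
      have h2 : ¬ (l' : ℕ) < l := fun h => hv'.2 l h hv.1
      exact Prod.ext rfl (Fin.ext (by simp; omega))
    simpa using this
  -- If the straight successor of `v` is in `D`, then so is its other predecessor, the flip partner
  -- of `v`. The missing successor of `v` is the straight successor of that partner, which is
  -- therefore the top of its column.
  have h2 : ((outNodes D).filter fun v => ¬ top v).card ≤ T.card := by
    apply Finset.card_le_card_of_injOn (fun v => (flipCol v.1 v.2, v.2))
    · intro v hv
      simp only [Finset.coe_filter, mem_outNodes, Set.mem_ofPred_eq] at hv
      obtain ⟨⟨hvD, hv2⟩, hnt⟩ := hv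
      rcases hv2 with h | ⟨u, hvu, hu⟩
      · exact absurd (htop_of v (Or.inl h)) hnt
      · obtain ⟨h1, h3⟩ := (adj_iff _ _).1 hvu
        have hva : (v.2 : ℕ) < a := by have := u.2.isLt; omega
        rcases h3 with h3 | h3
        · exact absurd (htop_of v (Or.inr ⟨u.2, h1, by rw [← h3]; exact hu⟩)) hnt
        · have hs : (v.1, u.2) ∈ D := by
            by_contra h
            exact hnt (htop_of v (Or.inr ⟨u.2, h1, h⟩))
          have hf : (flipCol v.1 v.2, v.2) ∈ D := by
            apply hD _ _ _ hs
            have := adj_flip (w := flipCol v.1 v.2) h1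
            rwa [flipCol_flipCol hva] at this
          simp only [T, Finset.coe_filter, Set.mem_ofPred_eq]
          refine ⟨hf, htop_of _ (Or.inr ⟨u.2, h1, ?_⟩)⟩
          show (flipCol v.1 v.2, u.2) ∉ D
          rw [← h3]
          exact hu
    · intro v hv v' hv' h
      simp only [Finset.coe_filter, mem_outNodes, Set.mem_ofPred_eq] at hv hv'
      simp only [Prod.mk.injEq] at h
      have hva : (v.2 : ℕ) < a := by
        by_contra hc
        exact hv.2 (htop_of v (Or.inl (by have := v.2.isLt; omega)))
      obtain ⟨h1, h2⟩ := h
      rw [← h2] at h1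
      exact Prod.ext (flipCol_injective hva h1) h2
  have h3 : ((outNodes D).filter top).card ≤ T.card := by
    apply Finset.card_le_card
    intro v hv
    simp only [Finset.mem_filter, mem_outNodes, T] at hv ⊢
    exact ⟨hv.1.1, hv.2⟩
  have := Finset.card_filter_add_card_filter_not (s := outNodes D) top
  omega

end Boundary

/-! ## Node sets with small boundaries -/

section Balance

variable {a : ℕ}

theorem node_level {w : Fin (2 ^ a)} {l : ℕ} (h : l ≤ a) : ((RecFFT.node w l).2 : ℕ) = l := by
  simp only [RecFFT.node, Fin.ofNat]
  exact Nat.mod_eq_of_lt (by omega)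

theorem node_adj_straight {w : Fin (2 ^ a)} {l : ℕ} (h : l < a) :
    (fftDAG a).Adj (RecFFT.node w l) (RecFFT.node w (l + 1)) :=
  adj_straight (by
    have h1 := node_level (w := w) h.le
    have h2 := node_level (w := w) (Nat.succ_le_of_lt h)
    exact h2.trans (congrArg Nat.succ h1.symm))

theorem eq_node (v : FFTNode a) : v = RecFFT.node v.1 v.2 :=
  Prod.ext rfl (Fin.ext (node_level (w := v.1) (by have := v.2.isLt; omega)).symm)

theorem exists_last_of_le {P : ℕ → Prop} {l l' : ℕ} (h : l ≤ l') (hl : P l) (hl' : ¬ P l') :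
    ∃ j, l ≤ j ∧ j < l' ∧ P j ∧ ¬ P (j + 1) := by
  induction l', h using Nat.le_induction with
  | base => exact absurd hl hl'
  | succ k hk ih =>
    by_cases hP : P k
    · exact ⟨k, hk, Nat.lt_succ_self k, hP, hl'⟩
    · obtain ⟨j, h1, h2, h3⟩ := ih hP
      exact ⟨j, h1, by omega, h3⟩

/-- The column whose bits below `l` are those of `w'`, the other ones being those of `w`. -/
def mixCol (l : ℕ) (w w' : Fin (2 ^ a)) : Fin (2 ^ a) :=
  Fin.ofNat (2 ^ a) (2 ^ l * ((w : ℕ) / 2 ^ l) + (w' : ℕ) % 2 ^ l)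

theorem mixCol_testBit {l : ℕ} (hl : l ≤ a) (w w' : Fin (2 ^ a)) (j : ℕ) :
    (mixCol l w w' : ℕ).testBit j =
      if j < l then (w' : ℕ).testBit j else (w : ℕ).testBit j := by
  have hb : ∀ j, (2 ^ l * ((w : ℕ) / 2 ^ l) + (w' : ℕ) % 2 ^ l).testBit j =
      if j < l then (w' : ℕ).testBit j else (w : ℕ).testBit j := by
    intro j
    rw [Nat.testBit_two_pow_mul_add _ (Nat.mod_lt _ (by positivity))]
    split_ifs with h
    · rw [Nat.testBit_mod_two_pow]; simp [h]
    · rw [Nat.testBit_div_two_pow]; congr 1; omega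
  have hlt : 2 ^ l * ((w : ℕ) / 2 ^ l) + (w' : ℕ) % 2 ^ l < 2 ^ a := by
    apply Nat.lt_pow_two_of_testBit
    intro i hi
    rw [hb, if_neg (by omega)]
    exact Nat.testBit_lt_two_pow (w.isLt.trans_le (Nat.pow_le_pow_right (by norm_num) hi))
  simp only [mixCol, Fin.ofNat, Nat.mod_eq_of_lt hlt]
  exact hb j

theorem fin_eq_of_testBit {w w' : Fin (2 ^ a)}
    (h : ∀ j, (w : ℕ).testBit j = (w' : ℕ).testBit j) : w = w' :=
  Fin.ext (Nat.eq_of_testBit_eq h)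

theorem mixCol_zero (w w' : Fin (2 ^ a)) : mixCol 0 w w' = w :=
  fin_eq_of_testBit fun j => by simp [mixCol_testBit]

theorem mixCol_self (w w' : Fin (2 ^ a)) : mixCol a w w' = w' :=
  fin_eq_of_testBit fun j => by
    rw [mixCol_testBit le_rfl]
    split_ifs with h
    · rfl
    · have hp : 2 ^ a ≤ 2 ^ j := Nat.pow_le_pow_right (by norm_num) (not_lt.1 h)
      rw [Nat.testBit_lt_two_pow (w.isLt.trans_le hp), Nat.testBit_lt_two_pow (w'.isLt.trans_le hp)]

/-- As `l` grows, these nodes form the path from input `w` to output `w'`: each arc corrects one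
bit. -/
theorem adj_mixCol {l : ℕ} (hl : l < a) (w w' : Fin (2 ^ a)) :
    (fftDAG a).Adj (RecFFT.node (mixCol l w w') l) (RecFFT.node (mixCol (l + 1) w w') (l + 1)) := by
  rw [adj_iff, node_level hl.le, node_level (Nat.succ_le_of_lt hl)]
  refine ⟨rfl, ?_⟩
  simp only [RecFFT.node]
  by_cases hb : (w : ℕ).testBit l = (w' : ℕ).testBit l
  · left
    apply fin_eq_of_testBit
    intro j
    rw [mixCol_testBit hl.le, mixCol_testBit (Nat.succ_le_of_lt hl)]
    rcases lt_trichotomy j l with h | h | h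
    · rw [if_pos (by omega), if_pos h]
    · rw [if_pos (by omega), if_neg (by omega), h, hb]
    · rw [if_neg (by omega), if_neg (by omega)]
  · right
    apply fin_eq_of_testBit
    intro j
    rw [flipCol_testBit hl, mixCol_testBit hl.le, mixCol_testBit (Nat.succ_le_of_lt hl)]
    rcases lt_trichotomy j l with h | h | h
    · rw [if_pos (by omega), if_pos h, decide_eq_false (by omega), Bool.xor_false]
    · rw [if_pos (by omega), if_neg (by omega), h, decide_eq_true rfl]
      revert hb
      cases (w : ℕ).testBit l <;> cases (w' : ℕ).testBit l <;> simp
    · rw [if_neg (by omega), if_neg (by omega), decide_eq_false (by omega), Bool.xor_false]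

open Classical in
/-- The columns whose node at level `l` belongs to `V`. -/
noncomputable def levelCols (V : Finset (FFTNode a)) (l : ℕ) : Finset (Fin (2 ^ a)) :=
  Finset.univ.filter fun w => RecFFT.node w l ∈ V

theorem mem_levelCols {V : Finset (FFTNode a)} {l : ℕ} {w : Fin (2 ^ a)} :
    w ∈ levelCols V l ↔ RecFFT.node w l ∈ V := by
  simp [levelCols]

theorem card_level_eq (V : Finset (FFTNode a)) {l : ℕ} (hl : l ≤ a) :
    (V.filter fun v => (v.2 : ℕ) = l).card = (levelCols V l).card := by
  apply Finset.card_nbij' (fun v => v.1) (fun w => RecFFT.node w l)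
  · intro v hv
    obtain ⟨h1, rfl⟩ := Finset.mem_filter.1 hv
    exact mem_levelCols.2 (by rwa [← eq_node])
  · intro w hw
    exact Finset.mem_filter.2 ⟨mem_levelCols.1 hw, node_level hl⟩
  · intro v hv
    obtain ⟨h1, rfl⟩ := Finset.mem_filter.1 hv
    exact (eq_node v).symm
  · intro w hw
    rfl

theorem card_eq_sum_levelCols (V : Finset (FFTNode a)) :
    V.card = ∑ l ∈ Finset.range (a + 1), (levelCols V l).card := by
  rw [Finset.card_eq_sum_card_fiberwise (f := fun v : FFTNode a => (v.2 : ℕ))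
    (t := Finset.range (a + 1)) fun v _ => by simpa using v.2.isLt]
  exact Finset.sum_congr rfl fun l hl =>
    card_level_eq V (Nat.lt_succ_iff.1 (Finset.mem_range.1 hl))

open Classical in
/-- The nodes of `V` with a successor outside `V`. -/
noncomputable def exits (V : Finset (FFTNode a)) : Finset (FFTNode a) :=
  V.filter fun v => ∃ u, (fftDAG a).Adj v u ∧ u ∉ V

open Classical in
/-- The nodes outside `V` with a successor in `V`. -/
noncomputable def entries (V : Finset (FFTNode a)) : Finset (FFTNode a) :=
  Finset.univ.filter fun u => u ∉ V ∧ ∃ v ∈ V, (fftDAG a).Adj u v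

/-- A column present at level `l'` but not at level `l` enters `V` in between, through a node of
that same column. -/
theorem card_levelCols_le_add_entries (V : Finset (FFTNode a)) {l l' : ℕ} (h : l ≤ l')
    (hl' : l' ≤ a) :
    (levelCols V l').card ≤ (levelCols V l).card + (entries V).card := by
  classical
  have h1 : (levelCols V l' \ levelCols V l).card ≤ (entries V).card := by
    apply Finset.card_le_card_of_forall_subsingleton (fun w u => u.1 = w)
    · intro w hw
      simp only [Finset.mem_sdiff, mem_levelCols] at hw
      obtain ⟨j, -, h2, h3, h4⟩ :=
        exists_last_of_le (P := fun j => ¬ RecFFT.node w j ∈ V) h hw.2 (not_not.2 hw.1)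
      exact ⟨_, Finset.mem_filter.2 ⟨Finset.mem_univ _, h3, _, not_not.1 h4,
        node_adj_straight (by omega)⟩, rfl⟩
    · rintro u - w ⟨-, hw⟩ w' ⟨-, hw'⟩
      exact hw.symm.trans hw'
  have := Finset.card_le_card_sdiff_add_card (s := levelCols V l') (t := levelCols V l)
  omega

/-- Every node is on `n` of the `n²` paths from inputs to outputs. -/
theorem card_mul_card_le_exits (V : Finset (FFTNode a)) :
    (levelCols V 0).card * (2 ^ a - (levelCols V a).card) ≤ (exits V).card * 2 ^ a := by
  classical
  have h := Finset.card_le_card_of_forall_subsingleton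
    (s := levelCols V 0 ×ˢ (levelCols V a)ᶜ)
    (t := exits V ×ˢ (Finset.univ : Finset (Fin (2 ^ a))))
    -- A node on the path from `w` to `w'` has the low bits of `w'` and the high bits of `w`. The
    -- second component records the other bits of both, so the pair determines `w` and `w'`.
    (fun x y => y.1.1 = mixCol y.1.2 x.1 x.2 ∧ y.2 = mixCol y.1.2 x.2 x.1) ?_ ?_
  · simpa [Finset.card_product, Finset.card_compl] using h
  · rintro ⟨w, w'⟩ hw
    simp only [Finset.mem_product, Finset.mem_compl, mem_levelCols] at hw
    obtain ⟨j, -, h2, h3, h4⟩ :=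
      exists_last_of_le (P := fun j => RecFFT.node (mixCol j w w') j ∈ V) (Nat.zero_le a)
        (by rw [mixCol_zero]; exact hw.1) (by rw [mixCol_self]; exact hw.2)
    refine ⟨(RecFFT.node (mixCol j w w') j, mixCol j w' w), ?_, ?_⟩
    · simp only [Finset.mem_product, Finset.mem_univ, and_true]
      exact Finset.mem_filter.2 ⟨h3, _, adj_mixCol h2 w w', h4⟩
    · simp only [node_level h2.le, and_true]
      rfl
  · rintro ⟨u, y⟩ - ⟨w, w'⟩ ⟨-, h1, h2⟩ ⟨z, z'⟩ ⟨-, h3, h4⟩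
    simp only at h1 h2 h3 h4
    have hl : (u.2 : ℕ) ≤ a := by have := u.2.isLt; omega
    have e1 := h1.symm.trans h3
    have e2 := h2.symm.trans h4
    have b1 : ∀ j, (mixCol u.2 w w' : ℕ).testBit j = (mixCol u.2 z z' : ℕ).testBit j := by
      rw [e1]; exact fun _ => rfl
    have b2 : ∀ j, (mixCol u.2 w' w : ℕ).testBit j = (mixCol u.2 z' z : ℕ).testBit j := by
      rw [e2]; exact fun _ => rfl
    simp only [mixCol_testBit hl] at b1 b2
    refine Prod.ext (fin_eq_of_testBit fun j => ?_) (fin_eq_of_testBit fun j => ?_)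
    · have := b1 j; have := b2 j
      split_ifs at * <;> assumption
    · have := b1 j; have := b2 j
      split_ifs at * <;> assumption

/-- A set of nodes that has at most the fraction `ε < 1` of the non-input nodes has a boundary that
is proportional to the average size of its levels. -/
theorem card_le_of_balanced (ha : 0 < a) (V : Finset (FFTNode a)) {ε B : ℝ} (h0 : 0 ≤ ε)
    (h1 : ε < 1) (hW : ((V.filter fun v => (v.2 : ℕ) ≠ 0).card : ℝ) ≤ ε * (2 ^ a * a))
    (hout : ((exits V).card : ℝ) ≤ B) (hin : ((entries V).card : ℝ) ≤ B) :
    (1 - ε) * V.card ≤ 3 * (a + 1) * B := by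
  have ha' : (0 : ℝ) < a := by exact_mod_cast ha
  have hB : 0 ≤ B := le_trans (by positivity) hout
  set x : ℝ := ((levelCols V 0).card : ℝ) with hx
  set y : ℝ := ((levelCols V a).card : ℝ) with hy
  have hn : (0 : ℝ) < 2 ^ a := by positivity
  have hxn : x ≤ 2 ^ a := by
    have := Finset.card_le_univ (levelCols V 0)
    rw [Fintype.card_fin] at this
    rw [hx]
    exact_mod_cast this
  have hcard : (V.card : ℝ) ≤ (a + 1) * (x + B) := by
    rw [card_eq_sum_levelCols V]
    push_cast
    refine (Finset.sum_le_card_nsmul _ _ (x + B) ?_).trans (by simp [mul_add])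
    intro l hl
    have := card_levelCols_le_add_entries V (Nat.zero_le l)
      (Nat.lt_succ_iff.1 (Finset.mem_range.1 hl))
    have : ((levelCols V l).card : ℝ) ≤ x + (entries V).card := by
      rw [hx]; exact_mod_cast this
    linarith
  -- Levels `1, …, a` have average size at most `ε n`, and level `a` exceeds each of them by at most
  -- the number of entries.
  have hya : y ≤ ε * 2 ^ a + B := by
    have e1 := Finset.card_filter_add_card_filter_not (s := V) fun v => (v.2 : ℕ) = 0
    rw [card_level_eq V (Nat.zero_le a), card_eq_sum_levelCols V, Finset.sum_range_succ'] at e1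
    have e2 : (V.filter fun v => (v.2 : ℕ) ≠ 0).card =
        ∑ l ∈ Finset.range a, (levelCols V (l + 1)).card := by
      simp only [ne_eq]; omega
    have e3 : (a : ℝ) * (y - B) ≤ ((V.filter fun v => (v.2 : ℕ) ≠ 0).card : ℝ) := by
      rw [e2]
      push_cast
      have := Finset.card_nsmul_le_sum (Finset.range a)
        (fun l => ((levelCols V (l + 1)).card : ℝ)) (y - B) ?_
      · simpa using this
      · intro l hl
        have := card_levelCols_le_add_entries V
          (Nat.succ_le_of_lt (Finset.mem_range.1 hl)) le_rfl
        have : y ≤ (levelCols V (l + 1)).card + (entries V).card := by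
          rw [hy]; exact_mod_cast this
        linarith
    have e4 : a * (y - B) ≤ a * (ε * 2 ^ a) := by linarith
    have := le_of_mul_le_mul_left e4 ha'
    linarith
  have hmul : x * (2 ^ a - y) ≤ B * 2 ^ a := by
    have e1 := card_mul_card_le_exits V
    have e2 : (levelCols V a).card ≤ 2 ^ a := by
      have := Finset.card_le_univ (levelCols V a)
      rwa [Fintype.card_fin] at this
    have e3 : x * (2 ^ a - y) ≤ (exits V).card * 2 ^ a := by
      have : (((levelCols V 0).card * (2 ^ a - (levelCols V a).card) : ℕ) : ℝ)
        ≤ (((exits V).card * 2 ^ a : ℕ) : ℝ) := by exact_mod_cast e1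
      push_cast [Nat.cast_sub e2] at this
      exact this
    nlinarith
  have hx0 : 0 ≤ x := by positivity
  have hkey : (1 - ε) * x ≤ 2 * B := by
    -- Either `B` is so large that `x ≤ n` suffices, or at least `(1 - ε) n / 2` outputs lie outside
    -- `V` and the path count applies.
    by_cases hc : (1 - ε) * 2 ^ a ≤ 2 * B
    · nlinarith
    · push Not at hc
      have e1 : (1 - ε) * 2 ^ a / 2 ≤ 2 ^ a - y := by linarith
      have e2 : x * ((1 - ε) * 2 ^ a / 2) ≤ B * 2 ^ a :=
        (mul_le_mul_of_nonneg_left e1 hx0).trans hmul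
      have e3 : 2 ^ a * ((1 - ε) * x) ≤ 2 ^ a * (2 * B) := by linarith
      exact le_of_mul_le_mul_left e3 hn
  calc (1 - ε) * V.card ≤ (1 - ε) * ((a + 1) * (x + B)) :=
        mul_le_mul_of_nonneg_left hcard (by linarith)
    _ = (a + 1) * ((1 - ε) * x + (1 - ε) * B) := by ring
    _ ≤ (a + 1) * (2 * B + 1 * B) := by gcongr; linarith
    _ = 3 * (a + 1) * B := by ring

end Balance

/-! ## Schedules of the FFT DAG -/

/-- The node evaluations of an execution on processors `ι`, in terms of the communication time,
which ends at `H`: in any time interval every processor sends at most `κ` values per unit of time,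
and altogether it receives at most `κ H` values. -/
structure Schedule (a : ℕ) (ι : Type) (κ H : ℕ) where
  own : FFTNode a → ι
  time : FFTNode a → ℕ
  time_mono : ∀ u v, (fftDAG a).Adj u v → time u ≤ time v
  time_le : ∀ v, time v ≤ H
  send : ∀ (r : ι) (τ₀ τ : ℕ), τ₀ ≤ τ → ∀ S : Finset (FFTNode a),
    (∀ u ∈ S, own u = r ∧ τ₀ ≤ time u ∧ ∃ v, (fftDAG a).Adj u v ∧ own v ≠ r ∧ time v ≤ τ) →
      S.card ≤ κ * (τ - τ₀)
  receive : ∀ (r : ι) (S : Finset (FFTNode a)),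
    (∀ u ∈ S, own u ≠ r ∧ ∃ v, (fftDAG a).Adj u v ∧ own v = r) → S.card ≤ κ * H

namespace Schedule

variable {a κ H : ℕ} {ι : Type} (𝒮 : Schedule a ι κ H)

open Classical in
/-- The nodes assigned to `r` with evaluation time in `[τ₀, τ]`. -/
noncomputable def window (r : ι) (τ₀ τ : ℕ) : Finset (FFTNode a) :=
  Finset.univ.filter fun v => 𝒮.own v = r ∧ τ₀ ≤ 𝒮.time v ∧ 𝒮.time v ≤ τ

open Classical in
/-- The nodes evaluated until time `τ`. -/
noncomputable def past (τ : ℕ) : Finset (FFTNode a) :=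
  Finset.univ.filter fun v => 𝒮.time v ≤ τ

open Classical in
/-- The nodes assigned to `r` that are live at time `τ`. -/
noncomputable def live (r : ι) (τ : ℕ) : Finset (FFTNode a) :=
  (outNodes (𝒮.past τ)).filter fun v => 𝒮.own v = r

open Classical in
/-- The output nodes assigned to `r`. -/
noncomputable def outputs (r : ι) : Finset (FFTNode a) :=
  Finset.univ.filter fun v => 𝒮.own v = r ∧ (v.2 : ℕ) = a

open Classical in
/-- All nodes assigned to `r`. -/
noncomputable def part (r : ι) : Finset (FFTNode a) :=
  Finset.univ.filter fun v => 𝒮.own v = r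

theorem mem_window {r : ι} {τ₀ τ : ℕ} {v : FFTNode a} : v ∈ 𝒮.window r τ₀ τ ↔
    𝒮.own v = r ∧ τ₀ ≤ 𝒮.time v ∧ 𝒮.time v ≤ τ := by simp [window]

theorem mem_past {τ : ℕ} {v : FFTNode a} : v ∈ 𝒮.past τ ↔ 𝒮.time v ≤ τ := by simp [past]

theorem mem_part {r : ι} {v : FFTNode a} : v ∈ 𝒮.part r ↔ 𝒮.own v = r := by simp [part]

/-- A boundary node of the window that is not live at `τ` has a successor outside the window
evaluated by time `τ`. That successor is not earlier than `τ₀`, so it belongs to another processor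
and the value was sent within the interval. -/
theorem card_outNodes_window_le (r : ι) {τ₀ τ : ℕ} (h : τ₀ ≤ τ) :
    (outNodes (𝒮.window r τ₀ τ)).card ≤ (𝒮.live r τ).card + κ * (τ - τ₀) := by
  classical
  have h1 : (outNodes (𝒮.window r τ₀ τ) \ 𝒮.live r τ).card ≤ κ * (τ - τ₀) := by
    apply 𝒮.send r τ₀ τ h
    intro u hu
    obtain ⟨hu, hl⟩ := Finset.mem_sdiff.1 hu
    obtain ⟨hw, ho⟩ := mem_outNodes.1 hu
    obtain ⟨h1, h2, h3⟩ := 𝒮.mem_window.1 hw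
    refine ⟨h1, h2, ?_⟩
    simp only [live, Finset.mem_filter, mem_outNodes, mem_past, h1, h3, true_and, and_true] at hl
    push Not at hl
    rcases ho with ho | ⟨v, huv, hv⟩
    · exact absurd ho hl.1
    · have h4 := hl.2 v huv
      refine ⟨v, huv, fun h5 => hv (𝒮.mem_window.2 ⟨h5, ?_, h4⟩), h4⟩
      exact h2.trans (𝒮.time_mono u v huv)
  have := Finset.card_le_card_sdiff_add_card (s := outNodes (𝒮.window r τ₀ τ))
    (t := 𝒮.live r τ)
  omega

theorem live_end (r : ι) : 𝒮.live r H ⊆ 𝒮.outputs r := by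
  intro v hv
  simp only [live, outputs, Finset.mem_filter, mem_outNodes, mem_past, Finset.mem_univ,
    true_and] at hv ⊢
  refine ⟨hv.2, ?_⟩
  rcases hv.1.2 with h | ⟨u, -, hu⟩
  · exact h
  · exact absurd (𝒮.time_le u) hu

/-- The past is closed under predecessors, so its whole frontier has at most `2n` nodes. -/
theorem sum_live_le [Fintype ι] (τ : ℕ) : ∑ r, (𝒮.live r τ).card ≤ 2 * 2 ^ a := by
  classical
  have h := Finset.card_eq_sum_card_fiberwise (f := 𝒮.own) (s := outNodes (𝒮.past τ))
    (t := Finset.univ) fun _ _ => Finset.mem_coe.2 (Finset.mem_univ _)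
  have h2 := card_outNodes_le_of_closed (𝒮.past τ) fun u v huv hv =>
    𝒮.mem_past.2 ((𝒮.time_mono u v huv).trans (𝒮.mem_past.1 hv))
  rw [h] at h2
  refine le_trans (Finset.sum_le_sum fun r _ => Finset.card_le_card ?_) h2
  intro v hv
  exact Finset.mem_filter.2 (Finset.mem_filter.1 hv)

theorem sum_part [Fintype ι] : ∑ r, (𝒮.part r).card = 2 ^ a * (a + 1) := by
  classical
  have h := Finset.card_eq_sum_card_fiberwise (f := 𝒮.own) (s := Finset.univ)
    (t := Finset.univ) fun _ _ => Finset.mem_coe.2 (Finset.mem_univ _)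
  simp only [Finset.card_univ, Fintype.card_prod, Fintype.card_fin] at h
  rw [h]
  refine Finset.sum_congr rfl fun r _ => ?_
  unfold part
  congr

theorem sum_outputs [Fintype ι] : ∑ r, (𝒮.outputs r).card = 2 ^ a := by
  classical
  have h := Finset.card_eq_sum_card_fiberwise (f := 𝒮.own)
    (s := Finset.univ.filter fun v : FFTNode a => (v.2 : ℕ) = a)
    (t := Finset.univ) fun _ _ => Finset.mem_coe.2 (Finset.mem_univ _)
  rw [card_level_eq _ le_rfl] at h
  have h2 : (levelCols (Finset.univ : Finset (FFTNode a)) a).card = 2 ^ a := by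
    simp [levelCols]
  rw [← h2, h]
  refine Finset.sum_congr rfl fun r _ => ?_
  rw [Finset.filter_filter]
  unfold outputs
  congr 1
  ext v
  simp [and_comm]

end Schedule

/-! ### Division of a processor's history into phases -/

theorem logb_two_le {x : ℝ} (hx : 0 < x) : Real.logb 2 x ≤ 2 * x := by
  have h2 : (1 : ℝ) / 2 ≤ Real.log 2 := by have := Real.log_two_gt_d9; linarith
  have h1 := Real.log_le_sub_one_of_pos hx
  rw [Real.logb, div_le_iff₀ (by linarith)]
  nlinarith

/-- The cost of a phase of length `j`, where `m` stands for `n/p` and `L` for the live values summed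
over the phase. Writing `2κj = 2(κm)(j/m)` leaves, beyond the linear term, an excess of about `4κ
j²/m` from `log₂(j/m) ≤ 2j/m`; its quadratic part is charged to `L`. -/
theorem xlog_le_of_sum_le {κ j : ℕ} (hκ : 1 ≤ κ) (hj : 1 ≤ j) {m L : ℝ} (hm : 1 ≤ m)
    (hL : κ * (j * (j - 1)) ≤ 2 * L) :
    xlog ((2 * κ * j : ℕ) : ℝ) ≤ 2 * κ * (4 + Real.logb 2 (κ * m)) * j + 8 / m * L := by
  have hκ' : (1 : ℝ) ≤ κ := by exact_mod_cast hκ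
  have hj' : (1 : ℝ) ≤ j := by exact_mod_cast hj
  have hm0 : 0 < m := by linarith
  have h1 : Real.logb 2 ((2 * κ * j : ℕ) : ℝ) ≤ 1 + Real.logb 2 (κ * m) + 2 * (j / m) := by
    have e : ((2 * κ * j : ℕ) : ℝ) = 2 * (κ * m) * (j / m) := by
      push_cast; field_simp
    rw [e, Real.logb_mul (by positivity) (by positivity), Real.logb_mul (by positivity)
      (by positivity), Real.logb_self_eq_one (by norm_num)]
    have := logb_two_le (x := (j : ℝ) / m) (by positivity)
    linarith
  have h2 : (j : ℝ) / m ≤ j := div_le_self (by linarith) hm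
  have h3 : 4 * (κ * (j * (j - 1))) / m ≤ 4 * (2 * L) / m := by gcongr
  have h4 : 2 * κ * j * (2 * ((j : ℝ) / m)) =
      4 * (κ * (j * (j - 1))) / m + 4 * κ * (j / m) := by field_simp; ring
  have h5 : 4 * (κ : ℝ) * (j / m) ≤ 4 * κ * j := by gcongr
  calc xlog ((2 * κ * j : ℕ) : ℝ)
      ≤ 2 * κ * j * (1 + (1 + Real.logb 2 (κ * m) + 2 * (j / m))) := by
        unfold xlog; push_cast at *; gcongr
    _ = 2 * κ * j * (2 + Real.logb 2 (κ * m)) + 2 * κ * j * (2 * (j / m)) := by ring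
    _ ≤ 2 * κ * j * (2 + Real.logb 2 (κ * m)) + (4 * (2 * L) / m + 4 * κ * j) := by
        rw [h4]; gcongr
    _ = _ := by ring

namespace Schedule

variable {a κ H : ℕ} {ι : Type} (𝒮 : Schedule a ι κ H)

/-- The nodes assigned to a processor from a time on are paid for by the communication time, the
live nodes, and the outputs of the processor. -/
theorem card_window_le (hκ : 1 ≤ κ) {m : ℝ} (hm : 1 ≤ m) (r : ι) (s : ℕ) :
    ∀ τ₀, τ₀ + s = H → ((𝒮.window r τ₀ H).card : ℝ) ≤
      2 * κ * (4 + Real.logb 2 (κ * m)) * s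
        + 8 / m * ∑ τ ∈ Finset.Ico τ₀ H, ((𝒮.live r τ).card : ℝ)
        + min (xlog ((2 * (𝒮.outputs r).card : ℕ) : ℝ)) (𝒮.part r).card := by
  classical
  have hκ' : (1 : ℝ) ≤ κ := by exact_mod_cast hκ
  have hlog : 0 ≤ Real.logb 2 (κ * m) :=
    Real.logb_nonneg (by norm_num) (by nlinarith)
  induction s using Nat.strong_induction_on with
  | _ s ih =>
  intro τ₀ hs
  -- `P j` says that a phase may end at `τ₀ + j`; the first such `j` is taken.
  let P : ℕ → Prop := fun j => 1 ≤ j ∧ j ≤ s ∧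
    ((𝒮.window r τ₀ (τ₀ + j)).card : ℝ) ≤ xlog ((2 * κ * j : ℕ) : ℝ)
  -- While the phase cannot end, the boundary exceeds `2κj`. At most `κj` of it has been sent, so
  -- the rest is live.
  have hlive : ∀ j, ¬ ((𝒮.window r τ₀ (τ₀ + j)).card : ℝ) ≤ xlog ((2 * κ * j : ℕ) : ℝ) →
      κ * j ≤ (𝒮.live r (τ₀ + j)).card := by
    intro j hj
    by_contra hc
    apply hj
    have h1 := 𝒮.card_outNodes_window_le r (Nat.le_add_right τ₀ j)
    rw [Nat.add_sub_cancel_left] at h1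
    refine (card_le_xlog_outNodes _).trans (xlog_mono ?_)
    rw [mul_assoc]; omega
  by_cases hex : ∃ j, P j
  · obtain ⟨hj1, hjs, hjc⟩ := Nat.find_spec hex
    set j := Nat.find hex with hj
    have hmin : ∀ i < j, κ * i ≤ (𝒮.live r (τ₀ + i)).card := by
      intro i hi
      rcases Nat.eq_zero_or_pos i with rfl | hi0
      · simp
      · apply hlive
        intro hc
        exact Nat.find_min hex hi ⟨hi0, by omega, hc⟩
    -- Summing `κ i` over the times before the end of the phase yields the quadratic lower bound on
    -- the live values.
    have hL : (κ : ℝ) * (j * (j - 1)) ≤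
        2 * ∑ τ ∈ Finset.Ico τ₀ (τ₀ + j), ((𝒮.live r τ).card : ℝ) := by
      rw [Finset.sum_Ico_eq_sum_range, Nat.add_sub_cancel_left]
      have h1 : ∑ i ∈ Finset.range j, κ * i ≤
          ∑ i ∈ Finset.range j, (𝒮.live r (τ₀ + i)).card :=
        Finset.sum_le_sum fun i hi => hmin i (Finset.mem_range.1 hi)
      rw [← Finset.mul_sum] at h1
      have h2 := Finset.sum_range_id_mul_two j
      have h3 : κ * (j * (j - 1)) ≤ 2 * ∑ i ∈ Finset.range j, (𝒮.live r (τ₀ + i)).card := by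
        rw [← h2]; nlinarith
      have h4 : ((κ * (j * (j - 1)) : ℕ) : ℝ) ≤
        ((2 * ∑ i ∈ Finset.range j, (𝒮.live r (τ₀ + i)).card : ℕ) : ℝ) := by exact_mod_cast h3
      push_cast [Nat.cast_sub hj1] at h4
      exact h4
    have h1 := xlog_le_of_sum_le hκ hj1 hm hL
    have h2 := ih (s - j) (by omega) (τ₀ + j) (by omega)
    have h3 : (𝒮.window r τ₀ H).card ≤
        (𝒮.window r τ₀ (τ₀ + j)).card + (𝒮.window r (τ₀ + j) H).card := by
      refine le_trans (Finset.card_le_card ?_) (Finset.card_union_le _ _)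
      intro v hv
      rw [Finset.mem_union, mem_window, mem_window]
      rw [mem_window] at hv
      rcases le_total (𝒮.time v) (τ₀ + j) with h | h
      · exact Or.inl ⟨hv.1, hv.2.1, h⟩
      · exact Or.inr ⟨hv.1, h, hv.2.2⟩
    have h4 : ((𝒮.window r τ₀ H).card : ℝ) ≤
        (𝒮.window r τ₀ (τ₀ + j)).card + (𝒮.window r (τ₀ + j) H).card := by exact_mod_cast h3
    rw [← Finset.sum_Ico_consecutive _ (Nat.le_add_right τ₀ j) (show τ₀ + j ≤ H by omega)]
    rw [Nat.cast_sub hjs] at h2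
    linarith
  · have hpart : (𝒮.window r τ₀ H).card ≤ (𝒮.part r).card :=
      Finset.card_le_card fun v hv => 𝒮.mem_part.2 (𝒮.mem_window.1 hv).1
    -- No phase ends before `H`: the live nodes at time `H` are outputs and number at least `κ s`,
    -- so the boundary is at most twice the number of outputs.
    have hout : ((𝒮.window r τ₀ H).card : ℝ) ≤ xlog ((2 * (𝒮.outputs r).card : ℕ) : ℝ) := by
      refine (card_le_xlog_outNodes _).trans (xlog_mono ?_)
      have h1 := 𝒮.card_outNodes_window_le r (show τ₀ ≤ H by omega)
      have h2 := Finset.card_le_card (𝒮.live_end r)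
      have h3 : H - τ₀ = s := by omega
      rw [h3] at h1
      rcases Nat.eq_zero_or_pos s with h0 | h0
      · subst h0; omega
      · have h4 : ¬ ((𝒮.window r τ₀ (τ₀ + s)).card : ℝ) ≤ xlog ((2 * κ * s : ℕ) : ℝ) :=
          fun hc => hex ⟨s, h0, le_rfl, hc⟩
        have h5 := hlive s h4
        rw [hs] at h5
        omega
    have h1 : 0 ≤ 8 / m * ∑ τ ∈ Finset.Ico τ₀ H, ((𝒮.live r τ).card : ℝ) := by positivity
    have h2 : 0 ≤ 2 * κ * (4 + Real.logb 2 (κ * m)) * (s : ℝ) := by positivity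
    have h3 : ((𝒮.window r τ₀ H).card : ℝ) ≤
        min (xlog ((2 * (𝒮.outputs r).card : ℕ) : ℝ)) (𝒮.part r).card :=
      le_min hout (by exact_mod_cast hpart)
    linarith

/-- If `2o ≤ 2^b`, the logarithm is at most `b`; otherwise `w ≤ 2^b < 2o`. This makes the output
term linear in `o`, so that it can be summed over the processors. -/
theorem min_xlog_le {o : ℕ} {w : ℝ} {b : ℕ} (hw : w ≤ 2 ^ b) :
    min (xlog ((2 * o : ℕ) : ℝ)) w ≤ 2 * o * (1 + b) := by
  have hb : (0 : ℝ) ≤ b := by positivity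
  by_cases ho : ((2 * o : ℕ) : ℝ) ≤ 2 ^ b
  · refine (min_le_left _ _).trans ?_
    rcases Nat.eq_zero_or_pos o with rfl | h0
    · simp [xlog]
    · have h1 : Real.logb 2 ((2 * o : ℕ) : ℝ) ≤ b := by
        rw [Real.logb_le_iff_le_rpow (by norm_num) (by positivity), Real.rpow_natCast]
        exact ho
      unfold xlog
      push_cast at *
      gcongr
  · push Not at ho
    refine (min_le_right _ _).trans ?_
    push_cast at ho
    have : (0 : ℝ) ≤ 2 * o := by positivity
    nlinarith

/-- The time lower bound when no processor is assigned more than `2 ^ b` nodes. -/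
theorem le_time_of_part_le [Fintype ι] (hκ : 1 ≤ κ) {m : ℝ} (hm : 1 ≤ m)
    (hp : Fintype.card ι * m = 2 ^ a) {b : ℕ} (hb : ∀ r, (𝒮.part r).card ≤ 2 ^ b) :
    m * (a - 1 - 2 * b) ≤ (2 * κ * (4 + Real.logb 2 (κ * m)) + 16) * H := by
  set A := 2 * κ * (4 + Real.logb 2 (κ * m)) with hA
  have hm0 : 0 < m := by linarith
  have h1 : ∀ r, ((𝒮.part r).card : ℝ) ≤ A * H +
      8 / m * ∑ τ ∈ Finset.range H, ((𝒮.live r τ).card : ℝ)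
        + 2 * (𝒮.outputs r).card * (1 + b) := by
    intro r
    have h2 := 𝒮.card_window_le hκ hm r H 0 (Nat.zero_add H)
    have h3 : 𝒮.window r 0 H = 𝒮.part r := by
      ext v
      rw [mem_window, mem_part]
      exact ⟨fun h => h.1, fun h => ⟨h, Nat.zero_le _, 𝒮.time_le v⟩⟩
    rw [h3, ← Finset.range_eq_Ico] at h2
    have h4 := min_xlog_le (o := (𝒮.outputs r).card) (w := (𝒮.part r).card) (b := b)
      (by exact_mod_cast hb r)
    linarith
  have h2 := Finset.sum_le_sum fun r (_ : r ∈ Finset.univ) => h1 r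
  have h3 : ∑ r, ((𝒮.part r).card : ℝ) = 2 ^ a * (a + 1) := by exact_mod_cast 𝒮.sum_part
  have h4 : ∑ r, ((𝒮.outputs r).card : ℝ) = 2 ^ a := by exact_mod_cast 𝒮.sum_outputs
  have h5 : ∑ r, ∑ τ ∈ Finset.range H, ((𝒮.live r τ).card : ℝ) ≤ H * (2 * 2 ^ a) := by
    rw [Finset.sum_comm]
    refine (Finset.sum_le_card_nsmul _ _ (2 * 2 ^ a) ?_).trans (by simp)
    intro τ _
    exact_mod_cast 𝒮.sum_live_le τ
  rw [h3, Finset.sum_add_distrib, Finset.sum_add_distrib, ← Finset.mul_sum, ← Finset.sum_mul,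
    ← Finset.mul_sum, ← Finset.mul_sum, h4, Finset.sum_const, Finset.card_univ, nsmul_eq_mul] at h2
  have h6 : 8 / m * ∑ r, ∑ τ ∈ Finset.range H, ((𝒮.live r τ).card : ℝ) ≤
      8 / m * (H * (2 * 2 ^ a)) := by gcongr
  -- As `p m = n`, the bound `2n` on the live values costs `16` per processor and unit of time.
  have h7 : 8 / m * (H * (2 * 2 ^ a)) = Fintype.card ι * (16 * H) := by
    rw [← hp]; field_simp; ring
  have hp0 : (0 : ℝ) < Fintype.card ι := by
    rcases (Nat.cast_nonneg (α := ℝ) (Fintype.card ι)).lt_or_eq with h | h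
    · exact h
    · rw [← h, zero_mul] at hp
      have : (0 : ℝ) < 2 ^ a := by positivity
      linarith
  have h8 : Fintype.card ι * (m * (a - 1 - 2 * b)) ≤ Fintype.card ι * ((A + 16) * H) := by
    have : Fintype.card ι * (m * (a - 1 - 2 * b)) = 2 ^ a * ((a : ℝ) - 1 - 2 * b) := by
      rw [← mul_assoc, hp]
    rw [this]
    linarith
  exact le_of_mul_le_mul_left h8 hp0

/-- Over the whole execution a processor sends at most `κ H` values and receives at most `κ H`,
which bounds the exits and the entries of its part. -/
theorem card_part_le (ha : 0 < a) {ε : ℝ} (h0 : 0 ≤ ε) (h1 : ε < 1) (r : ι)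
    (hW : (((𝒮.part r).filter fun v => (v.2 : ℕ) ≠ 0).card : ℝ) ≤ ε * (2 ^ a * a)) :
    (1 - ε) * (𝒮.part r).card ≤ 3 * (a + 1) * (κ * H) := by
  classical
  apply card_le_of_balanced ha _ h0 h1 hW
  · have : (exits (𝒮.part r)).card ≤ κ * (H - 0) := by
      apply 𝒮.send r 0 H (Nat.zero_le H)
      intro u hu
      obtain ⟨hu, v, huv, hv⟩ := Finset.mem_filter.1 hu
      rw [mem_part] at hu hv
      exact ⟨hu, Nat.zero_le _, v, huv, hv, 𝒮.time_le v⟩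
    exact_mod_cast this
  · have : (entries (𝒮.part r)).card ≤ κ * H := by
      apply 𝒮.receive r
      intro u hu
      obtain ⟨-, hu, v, hv, huv⟩ := Finset.mem_filter.1 hu
      rw [mem_part] at hu hv
      exact ⟨hu, v, huv, hv⟩
    exact_mod_cast this

end Schedule

/-! ### The time lower bound for balanced schedules -/

namespace Schedule

theorem exists_part_ge {a d κ H : ℕ} (hd : d ≤ a) (𝒮 : Schedule a (Fin (2 ^ d)) κ H) :
    ∃ r, 2 ^ (a - d) * (a + 1) ≤ (𝒮.part r).card := by
  have h : ∑ _r : Fin (2 ^ d), 2 ^ (a - d) * (a + 1) ≤ ∑ r, (𝒮.part r).card := by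
    rw [𝒮.sum_part, Finset.sum_const, Finset.card_univ, Fintype.card_fin, smul_eq_mul,
      ← mul_assoc, ← pow_add, Nat.add_sub_cancel' hd]
  obtain ⟨r, -, hr⟩ := Finset.exists_le_of_sum_le ⟨0, Finset.mem_univ _⟩ h
  exact ⟨r, hr⟩

theorem mul_succ_le_pow (a : ℕ) : a * (a + 1) ≤ 1024 * 2 ^ (2 * (a / 32)) := by
  have h1 : a / 32 + 1 ≤ 2 ^ (a / 32) := Nat.lt_two_pow_self
  have h2 : a + 1 ≤ 32 * 2 ^ (a / 32) := by omega
  calc a * (a + 1) ≤ (32 * 2 ^ (a / 32)) * (32 * 2 ^ (a / 32)) :=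
        Nat.mul_le_mul (by omega) h2
    _ = 1024 * 2 ^ (2 * (a / 32)) := by rw [two_mul, pow_add]; ring

/-- The communication time of a balanced schedule is `Ω((n / p) log n / log (n / p))`. -/
theorem exists_le_time {ε : ℝ} (h0 : 0 ≤ ε) (h1 : ε < 1) {κ : ℕ} (hκ : 1 ≤ κ) :
    ∃ δ : ℝ, 0 < δ ∧ ∀ (a d H : ℕ) (𝒮 : Schedule a (Fin (2 ^ d)) κ H), 0 < a → d ≤ a →
      (∀ r, (((𝒮.part r).filter fun v => (v.2 : ℕ) ≠ 0).card : ℝ) ≤ ε * (2 ^ a * a)) →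
      δ * (2 ^ (a - d) * (a / max 1 ((a - d : ℕ) : ℝ))) ≤ H := by
  have hκ' : (1 : ℝ) ≤ κ := by exact_mod_cast hκ
  have hlog : 0 ≤ Real.logb 2 (κ : ℝ) := Real.logb_nonneg (by norm_num) hκ'
  set c : ℝ := (1 - ε) / (3 * κ) with hc
  set C : ℝ := 2 * κ * (5 + Real.logb 2 κ) + 16 with hC
  have hc0 : 0 < c := div_pos (by linarith) (by linarith)
  have hC0 : 0 < C := by positivity
  refine ⟨min (c / 1024) (1 / (2 * C)), lt_min (by positivity) (by positivity), ?_⟩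
  intro a d H 𝒮 ha hd hbal
  set δ := min (c / 1024) (1 / (2 * C))
  have hδ0 : 0 < δ := lt_min (by positivity) (by positivity)
  have hδ1 : δ ≤ c / 1024 := min_le_left _ _
  have hδ2 : δ ≤ 1 / (2 * C) := min_le_right _ _
  set s := a - d with hs
  have ha' : (1 : ℝ) ≤ a := by exact_mod_cast ha
  have hM1 : (1 : ℝ) ≤ max 1 (s : ℝ) := le_max_left _ _
  have hMs : (s : ℝ) ≤ max 1 (s : ℝ) := le_max_right _ _
  set M := max 1 (s : ℝ)
  have hpart : ∀ r, c * (𝒮.part r).card ≤ (a + 1) * H := by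
    intro r
    have := 𝒮.card_part_le ha h0 h1 r (hbal r)
    rw [hc, div_mul_eq_mul_div, div_le_iff₀ (by positivity)]
    linarith
  have h2s : (0 : ℝ) < 2 ^ s := by positivity
  -- Here `log n = O(log(n/p))`, so `H = Ω(n/p)` is enough; it follows from a part of at least
  -- average size.
  by_cases hsmall : a ≤ 16 * (s + 1)
  · obtain ⟨r, hr⟩ := 𝒮.exists_part_ge hd
    have hr' : (2 : ℝ) ^ s * (a + 1) ≤ (𝒮.part r).card := by exact_mod_cast hr
    have e1 : c * 2 ^ s ≤ H := by
      have e2 : (a + 1) * (c * 2 ^ s) ≤ (a + 1) * (H : ℝ) := by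
        calc (a + 1) * (c * 2 ^ s) = c * (2 ^ s * (a + 1)) := by ring
          _ ≤ c * (𝒮.part r).card := by gcongr
          _ ≤ _ := hpart r
      exact le_of_mul_le_mul_left e2 (by linarith)
    have e3 : (a : ℝ) / M ≤ 32 := by
      rw [div_le_iff₀ (by linarith)]
      have : (a : ℝ) ≤ 16 * (s + 1) := by exact_mod_cast hsmall
      linarith
    calc δ * (2 ^ s * (a / M)) ≤ c / 1024 * (2 ^ s * 32) := by gcongr
      _ ≤ c * 2 ^ s := by nlinarith [mul_pos hc0 h2s]
      _ ≤ H := e1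
  push Not at hsmall
  have hdivM : (a : ℝ) / M ≤ a := div_le_self (by linarith) hM1
  -- Now `n/p < n^(1/16)`. A part with more than about `n^(1/8)` nodes leaves a power of `n` to
  -- spare, which absorbs `a (a + 1)` by `mul_succ_le_pow`.
  by_cases hbig : ∃ r, 2 ^ (a / 8) < (𝒮.part r).card
  · obtain ⟨r, hr⟩ := hbig
    have e1 : 2 ^ s * 2 ^ (2 * (a / 32)) ≤ (𝒮.part r).card := by
      rw [← pow_add]
      exact (Nat.pow_le_pow_right (by norm_num) (by omega)).trans hr.le
    have e2 : (2 : ℝ) ^ s * 2 ^ (2 * (a / 32)) ≤ (𝒮.part r).card := by exact_mod_cast e1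
    have e3 : (a : ℝ) * (a + 1) ≤ 1024 * 2 ^ (2 * (a / 32)) := by
      exact_mod_cast mul_succ_le_pow a
    have e4 : (a + 1) * (c / 1024 * (2 ^ s * a)) ≤ (a + 1) * (H : ℝ) := by
      calc (a + 1) * (c / 1024 * (2 ^ s * a)) = c / 1024 * 2 ^ s * (a * (a + 1)) := by ring
        _ ≤ c / 1024 * 2 ^ s * (1024 * 2 ^ (2 * (a / 32))) := by gcongr
        _ = c * (2 ^ s * 2 ^ (2 * (a / 32))) := by ring
        _ ≤ c * (𝒮.part r).card := by gcongr
        _ ≤ _ := hpart r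
    have e5 := le_of_mul_le_mul_left e4 (by linarith)
    calc δ * (2 ^ s * (a / M)) ≤ c / 1024 * (2 ^ s * a) := by gcongr
      _ ≤ H := e5
  · push Not at hbig
    have e1 := 𝒮.le_time_of_part_le hκ (m := 2 ^ s) (one_le_pow₀ (by norm_num))
      (by rw [Fintype.card_fin]; push_cast; rw [← pow_add, Nat.add_sub_cancel' hd]) hbig
    have e2 : Real.logb 2 (κ * 2 ^ s : ℝ) = Real.logb 2 κ + s := by
      rw [Real.logb_mul (by positivity) (by positivity), Real.logb_pow,
        Real.logb_self_eq_one (by norm_num), mul_one]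
    rw [e2] at e1
    -- With `b = a / 8` the term of the outputs removes at most half of `a`, since `a > 16`.
    have e3 : (a : ℝ) / 2 ≤ a - 1 - 2 * (a / 8 : ℕ) := by
      have : a + 2 + 4 * (a / 8) ≤ 2 * a := by omega
      have : (a : ℝ) + 2 + 4 * (a / 8 : ℕ) ≤ 2 * a := by exact_mod_cast this
      linarith
    have e4 : 2 * κ * (4 + (Real.logb 2 κ + s)) + 16 ≤ C * M := by
      have : (4 + (Real.logb 2 (κ : ℝ) + s)) ≤ (5 + Real.logb 2 κ) * M := by nlinarith
      calc 2 * κ * (4 + (Real.logb 2 κ + s)) + 16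
          ≤ 2 * κ * ((5 + Real.logb 2 κ) * M) + 16 * M := by gcongr; linarith
        _ = C * M := by rw [hC]; ring
    have e5 : 2 ^ s * ((a : ℝ) / 2) ≤ C * M * H :=
      (mul_le_mul_of_nonneg_left e3 h2s.le).trans (e1.trans (by gcongr))
    calc δ * (2 ^ s * (a / M)) ≤ 1 / (2 * C) * (2 ^ s * (a / M)) := by gcongr
      _ = (2 ^ s * ((a : ℝ) / 2)) / (C * M) := by field_simp
      _ ≤ H := by rw [div_le_iff₀ (by positivity)]; linarith

end Schedule

/-! ## The schedule of an algorithm -/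

section Execution

variable {V : Type} {d : ℕ}

/-- The superstep in which nothing happens. -/
def Superstep.idle : Superstep V d := ⟨0, fun _ => 0, 0⟩

theorem Superstep.idle_legal (G : Digraph V) (M : Fin (2 ^ d) → Set V) :
    (Superstep.idle : Superstep V d).Legal G M :=
  ⟨fun _ _ hv => absurd hv (Multiset.notMem_zero _), fun _ hm => absurd hm (Multiset.notMem_zero _)⟩

/-- The local memories before the `i`-th superstep. -/
def memoryAt (M : Fin (2 ^ d) → Set V) (ss : List (Superstep V d)) : ℕ → Fin (2 ^ d) → Set V
  | 0 => M
  | i + 1 => (ss.getD i .idle).next (memoryAt M ss i)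

theorem memoryAt_cons (M : Fin (2 ^ d) → Set V) (s : Superstep V d) (ss : List (Superstep V d))
    (i : ℕ) : memoryAt M (s :: ss) (i + 1) = memoryAt (s.next M) ss i := by
  induction i with
  | zero => rfl
  | succ i ih =>
    rw [memoryAt, ih]
    rfl

theorem legal_memoryAt {G : Digraph V} {ss : List (Superstep V d)} :
    ∀ {M : Fin (2 ^ d) → Set V}, StaticAlg.LegalRun G M ss → ∀ i,
      (ss.getD i .idle).Legal G (memoryAt M ss i) := by
  induction ss with
  | nil => exact fun _ i => by simpa using Superstep.idle_legal _ _
  | cons s ss ih =>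
    intro M h i
    cases i with
    | zero => exact h.1
    | succ i =>
      rw [memoryAt_cons]
      exact ih h.2 i

theorem sum_map_eq_sum_range {α : Type} (ss : List α) (e : α) (f : α → ℕ) :
    (ss.map f).sum = ∑ i ∈ Finset.range ss.length, f (ss.getD i e) := by
  induction ss with
  | nil => simp
  | cons s ss ih =>
    rw [List.map_cons, List.sum_cons, List.length_cons, Finset.sum_range_succ', ih, add_comm]
    simp

theorem Superstep.sent_le_degree (s : Superstep V d) (r : Fin (2 ^ d)) : s.sent r ≤ s.degree :=
  (le_max_left _ _).trans
    (Finset.le_sup (f := fun r => max (s.sent r) (s.received r)) (Finset.mem_univ r))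

theorem Superstep.received_le_degree (s : Superstep V d) (r : Fin (2 ^ d)) :
    s.received r ≤ s.degree :=
  (le_max_right _ _).trans
    (Finset.le_sup (f := fun r => max (s.sent r) (s.received r)) (Finset.mem_univ r))

theorem Superstep.degree_eq_zero {G : Digraph V} {M : Fin (2 ^ d) → Set V} {s : Superstep V d}
    (h : s.Legal G M) (hd : d ≤ s.label) : s.degree = 0 := by
  have hsame : ∀ m ∈ s.msgs, m.src = m.dst := by
    intro m hm
    have := (h.2 m hm).1
    rw [SameCluster, Nat.sub_eq_zero_of_le hd] at this
    simpa [Fin.ext_iff] using this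
  rw [Superstep.degree, ← Nat.bot_eq_zero, Finset.sup_eq_bot_iff]
  intro r _
  rw [Nat.bot_eq_zero, Nat.max_eq_zero_iff, Superstep.sent, Superstep.received,
    Multiset.card_eq_zero, Multiset.card_eq_zero, Multiset.filter_eq_nil, Multiset.filter_eq_nil]
  constructor
  · rintro m hm ⟨h1, h2⟩
    exact h2 ((hsame m hm).symm.trans h1)
  · rintro m hm ⟨h1, h2⟩
    exact h2 ((hsame m hm).trans h1)

theorem sum_label_eq (ss : List (Superstep V d)) (h : ∀ s ∈ ss, d ≤ s.label → s.degree = 0) :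
    ∑ i ∈ Finset.range d, ((ss.filter (fun s => s.label = i)).map Superstep.degree).sum
      = (ss.map Superstep.degree).sum := by
  induction ss with
  | nil => simp
  | cons s ss ih =>
    rw [List.map_cons, List.sum_cons, ← ih fun s' hs' => h s' (List.mem_cons_of_mem _ hs')]
    have e1 : ∀ i, (((s :: ss).filter (fun s => s.label = i)).map Superstep.degree).sum =
        (if s.label = i then s.degree else 0) +
          ((ss.filter (fun s => s.label = i)).map Superstep.degree).sum := by
      intro i
      by_cases hi : s.label = i <;> simp [hi]
    rw [Finset.sum_congr rfl fun i _ => e1 i, Finset.sum_add_distrib, Finset.sum_ite_eq]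
    congr 1
    split_ifs with hd
    · rfl
    · exact (h s List.mem_cons_self (by simpa using hd)).symm

theorem card_le_of_payload {κ : ℕ} (ms : Multiset (Message V d))
    (hκ : ∀ m ∈ ms, m.payload.card ≤ κ) (P : Message V d → Prop) [DecidablePred P]
    (S : Finset V)
    (hS : ∀ v ∈ S, ∃ m ∈ ms, P m ∧ v ∈ m.payload) : S.card ≤ κ * (ms.filter P).card := by
  classical
  have h1 : S ⊆ ((ms.filter P).bind fun m => m.payload.val).toFinset := by
    intro v hv
    obtain ⟨m, hm, hP, hvm⟩ := hS v hv
    rw [Multiset.mem_toFinset, Multiset.mem_bind]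
    exact ⟨m, Multiset.mem_filter.2 ⟨hm, hP⟩, hvm⟩
  refine (Finset.card_le_card h1).trans ((Multiset.toFinset_card_le _).trans ?_)
  rw [Multiset.card_bind]
  have h2 := Multiset.sum_le_card_nsmul
    ((ms.filter P).map (Multiset.card ∘ fun m => m.payload.val)) κ ?_
  · rw [Multiset.card_map, smul_eq_mul, Nat.mul_comm] at h2
    exact h2
  · intro x hx
    obtain ⟨m, hm, rfl⟩ := Multiset.mem_map.1 hx
    exact hκ m (Multiset.mem_filter.1 hm).1

/-- The time intervals of the supersteps are consecutive, so those contained in `[τ₀, τ]` have total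
length at most `τ - τ₀`. The minimum on the right is what makes the induction on `N` work. -/
theorem sum_within_le (f : ℕ → ℕ) (τ₀ τ N : ℕ) :
    ∑ j ∈ (Finset.range N).filter (fun j => τ₀ ≤ ∑ i ∈ Finset.range j, f i ∧
      ∑ i ∈ Finset.range (j + 1), f i ≤ τ), f j ≤ min (∑ i ∈ Finset.range N, f i) τ - τ₀ := by
  induction N with
  | zero => simp
  | succ N ih =>
    rw [Finset.range_add_one, Finset.filter_insert, ← Finset.range_add_one]
    have hs := Finset.sum_range_succ f N
    split_ifs with h
    · rw [Finset.sum_insert (by simp)]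
      omega
    · omega

theorem exists_eq_one_of_sum {ι : Type} {s : Finset ι} {f : ι → ℕ} (h : ∑ i ∈ s, f i = 1) :
    ∃ i ∈ s, f i ≠ 0 ∧ ∀ j ∈ s, f j ≠ 0 → j = i := by
  classical
  obtain ⟨i, hi, hfi⟩ := Finset.exists_ne_zero_of_sum_ne_zero (h.trans_ne one_ne_zero)
  refine ⟨i, hi, hfi, fun j hj hfj => ?_⟩
  by_contra hne
  have h1 : ∑ k ∈ {i, j}, f k ≤ ∑ k ∈ s, f k :=
    Finset.sum_le_sum_of_subset (by
      intro k hk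
      rcases Finset.mem_insert.1 hk with rfl | hk
      · exact hi
      · rwa [Finset.mem_singleton.1 hk])
  rw [Finset.sum_pair (Ne.symm hne)] at h1
  omega

/-! ### From an algorithm to its schedule -/

namespace StaticAlg

/-- The `i`-th superstep. -/
def stepAt (B : StaticAlg V d) (i : ℕ) : Superstep V d := B.steps.getD i .idle

/-- The local memories before the `i`-th superstep. -/
def memory (B : StaticAlg V d) : ℕ → Fin (2 ^ d) → Set V :=
  memoryAt (fun r => {v | v ∈ B.init r}) B.steps

/-- The communication time before the `i`-th superstep. -/
def clock (B : StaticAlg V d) (i : ℕ) : ℕ := ∑ j ∈ Finset.range i, (B.stepAt j).degree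

/-- `own v` is the only processing element that evaluates or initially holds `v`, and `step v` is
the superstep of the evaluation. -/
structure IsPlacement (G : Digraph V) (B : StaticAlg V d) (own : V → Fin (2 ^ d))
    (step : V → ℕ) : Prop where
  valid : B.Valid G
  of_init : ∀ v r, v ∈ B.init r → own v = r
  of_comp : ∀ v i r, v ∈ (B.stepAt i).comp r → own v = r ∧ step v = i
  step_input : ∀ v, IsInputNode G v → step v = 0
  mem_comp : ∀ v, ¬ IsInputNode G v → v ∈ (B.stepAt (step v)).comp (own v)
  step_le : ∀ v, step v ≤ B.steps.length

theorem Valid.legal {G : Digraph V} {B : StaticAlg V d} (h : B.Valid G) (i : ℕ) :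
    (B.stepAt i).Legal G (B.memory i) := legal_memoryAt h.2 i

theorem stepAt_of_le (B : StaticAlg V d) {i : ℕ} (h : B.steps.length ≤ i) :
    B.stepAt i = .idle := by
  simp [stepAt, List.getElem?_eq_none h]

/-- The counts equal to one make owner and superstep unique. Validity separates the two kinds of
node: inputs are never evaluated and other nodes are never present initially. -/
theorem exists_isPlacement [DecidableEq V] {G : Digraph V} {B : StaticAlg V d} (hB : B.Valid G)
    (he : ∀ v, ¬ IsInputNode G v → B.evalCount v = 1)
    (hi : ∀ v, IsInputNode G v → B.initCount v = 1) :
    ∃ own step, B.IsPlacement G own step := by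
  have key : ∀ v, ∃ (r : Fin (2 ^ d)) (i : ℕ), (∀ r', v ∈ B.init r' → r = r') ∧
      (∀ i' r', v ∈ (B.stepAt i').comp r' → r = r' ∧ i = i') ∧
      (IsInputNode G v → i = 0) ∧ (¬ IsInputNode G v → v ∈ (B.stepAt i).comp r) ∧
      i ≤ B.steps.length := by
    intro v
    by_cases hv : IsInputNode G v
    · obtain ⟨r, -, hr, huniq⟩ := exists_eq_one_of_sum (hi v hv)
      refine ⟨r, 0, fun r' hr' => ?_, fun i' r' hr' => ?_, fun _ => rfl, fun h => absurd hv h,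
        Nat.zero_le _⟩
      · exact (huniq r' (Finset.mem_univ _) (Multiset.count_ne_zero.2 hr')).symm
      · exact absurd hv ((hB.legal i').1 r' v hr').1
    · have h1 := he v hv
      rw [evalCount, sum_map_eq_sum_range _ Superstep.idle, ← Finset.sum_product'
        (Finset.range B.steps.length) Finset.univ
        (fun i r => ((B.steps.getD i Superstep.idle).comp r).count v)] at h1
      obtain ⟨⟨i, r⟩, hir, hne, huniq⟩ := exists_eq_one_of_sum h1
      refine ⟨r, i, fun r' hr' => ?_, fun i' r' hr' => ?_, fun h => absurd h hv,
        fun _ => Multiset.count_ne_zero.1 hne, ?_⟩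
      · exact absurd (hB.1 r' v hr') hv
      · have hlt : i' < B.steps.length := by
          by_contra hc
          rw [B.stepAt_of_le (not_lt.1 hc)] at hr'
          exact absurd hr' (Multiset.notMem_zero _)
        have := huniq (i', r') (by simp [hlt]) (Multiset.count_ne_zero.2 hr')
        rw [Prod.mk.injEq] at this
        exact ⟨this.2.symm, this.1.symm⟩
      · simp only [Finset.mem_product, Finset.mem_range] at hir
        exact hir.1.le
  choose own step h using key
  exact ⟨own, step, hB, fun v r => (h v).1 r, fun v i r => (h v).2.1 i r, fun v => (h v).2.2.1,
    fun v => (h v).2.2.2.1, fun v => (h v).2.2.2.2⟩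

theorem mem_memory_succ {B : StaticAlg V d} {i : ℕ} {r : Fin (2 ^ d)} {v : V} :
    v ∈ B.memory (i + 1) r ↔ v ∈ B.memory i r ∨ v ∈ (B.stepAt i).comp r ∨
      ∃ m ∈ (B.stepAt i).msgs, m.dst = r ∧ v ∈ m.payload := Iff.rfl

theorem clock_mono (B : StaticAlg V d) : Monotone B.clock := fun _ _ h =>
  Finset.sum_le_sum_of_subset (Finset.range_mono h)

namespace IsPlacement

variable {G : Digraph V} {B : StaticAlg V d} {own : V → Fin (2 ^ d)} {step : V → ℕ}

theorem step_le_of_mem (h : B.IsPlacement G own step) {v : V} (i : ℕ) :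
    ∀ r, v ∈ B.memory i r → step v ≤ i := by
  induction i with
  | zero =>
    intro r hv
    exact (h.step_input v (h.valid.1 r v hv)).le
  | succ i ih =>
    intro r hv
    rcases mem_memory_succ.1 hv with hv | hv | ⟨m, hm, -, hv⟩
    · exact (ih r hv).trans (Nat.le_succ i)
    · exact (h.of_comp v i r hv).2.le.trans (Nat.le_succ i)
    · rcases ((h.valid.legal i).2 m hm).2 v hv with hv | hv
      · exact (ih _ hv).trans (Nat.le_succ i)
      · exact (h.of_comp v i _ hv).2.le.trans (Nat.le_succ i)

theorem exists_received (h : B.IsPlacement G own step) {v : V} {r : Fin (2 ^ d)} (hr : own v ≠ r)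
    (i : ℕ) (hv : v ∈ B.memory i r) :
    ∃ j < i, ∃ m ∈ (B.stepAt j).msgs, (m.dst = r ∧ m.src ≠ r) ∧ v ∈ m.payload := by
  induction i with
  | zero => exact absurd (h.of_init v r hv) hr
  | succ i ih =>
    rcases mem_memory_succ.1 hv with hv | hv | ⟨m, hm, hd, hv⟩
    · obtain ⟨j, hj, hm⟩ := ih hv
      exact ⟨j, hj.trans (Nat.lt_succ_self i), hm⟩
    · exact absurd (h.of_comp v i r hv).1 hr
    · by_cases hs : m.src = r
      · rcases ((h.valid.legal i).2 m hm).2 v hv with hv | hv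
        · obtain ⟨j, hj, hm⟩ := ih (hs ▸ hv)
          exact ⟨j, hj.trans (Nat.lt_succ_self i), hm⟩
        · exact absurd ((h.of_comp v i _ hv).1.trans hs) hr
      · exact ⟨i, Nat.lt_succ_self i, m, hm, ⟨hd, hs⟩, hv⟩

/-- A copy held elsewhere may have been relayed; tracing it back leads to a message sent by the
owner itself, not before the evaluation. -/
theorem exists_sent (h : B.IsPlacement G own step) {v : V} (i : ℕ) :
    ∀ r, own v ≠ r → v ∈ B.memory i r → ∃ j < i, step v ≤ j ∧ ∃ m ∈ (B.stepAt j).msgs,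
      (m.src = own v ∧ m.dst ≠ own v) ∧ v ∈ m.payload := by
  induction i with
  | zero => exact fun r hr hv => absurd (h.of_init v r hv) hr
  | succ i ih =>
    intro r hr hv
    rcases mem_memory_succ.1 hv with hv | hv | ⟨m, hm, hd, hv⟩
    · obtain ⟨j, hj, hm⟩ := ih r hr hv
      exact ⟨j, hj.trans (Nat.lt_succ_self i), hm⟩
    · exact absurd (h.of_comp v i r hv).1 hr
    · by_cases hs : own v = m.src
      · refine ⟨i, Nat.lt_succ_self i, ?_, m, hm, ⟨hs.symm, fun hc => hr (hc.symm.trans hd)⟩, hv⟩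
        rcases ((h.valid.legal i).2 m hm).2 v hv with hv | hv
        · exact h.step_le_of_mem i _ hv
        · exact (h.of_comp v i _ hv).2.le
      · rcases ((h.valid.legal i).2 m hm).2 v hv with hv | hv
        · obtain ⟨j, hj, hm⟩ := ih _ hs hv
          exact ⟨j, hj.trans (Nat.lt_succ_self i), hm⟩
        · exact absurd (h.of_comp v i _ hv).1 hs

theorem mem_of_adj (h : B.IsPlacement G own step) {u v : V} (huv : G.Adj u v) :
    u ∈ B.memory (step v) (own v) ∨ (own u = own v ∧ step u = step v) := by
  have hv : ¬ IsInputNode G v := fun hc => hc u huv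
  rcases ((h.valid.legal (step v)).1 (own v) v (h.mem_comp v hv)).2 u huv with hu | hu
  · exact Or.inl hu
  · exact Or.inr (h.of_comp u _ _ hu)

theorem step_mono (h : B.IsPlacement G own step) {u v : V} (huv : G.Adj u v) :
    step u ≤ step v := by
  rcases h.mem_of_adj huv with hu | hu
  · exact h.step_le_of_mem _ _ hu
  · exact hu.2.le

theorem lt_length {j : ℕ} {m : Message V d} (hm : m ∈ (B.stepAt j).msgs) :
    j < B.steps.length := by
  by_contra hc
  rw [B.stepAt_of_le (not_lt.1 hc)] at hm
  exact absurd hm (Multiset.notMem_zero _)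

theorem message_size {κ : ℕ} (hκ : ∀ s ∈ B.steps, ∀ m ∈ s.msgs, m.payload.card ≤ κ) (j : ℕ) :
    ∀ m ∈ (B.stepAt j).msgs, m.payload.card ≤ κ := by
  intro m hm
  have hj := lt_length hm
  rw [stepAt, List.getD_eq_getElem _ _ hj] at hm
  exact hκ _ (List.getElem_mem hj) m hm

/-- The schedule of an algorithm for the FFT DAG. -/
noncomputable def schedule {a κ : ℕ} {B : StaticAlg (FFTNode a) d}
    {own : FFTNode a → Fin (2 ^ d)} {step : FFTNode a → ℕ}
    (h : B.IsPlacement (fftDAG a) own step)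
    (hκ : ∀ s ∈ B.steps, ∀ m ∈ s.msgs, m.payload.card ≤ κ) :
    Schedule a (Fin (2 ^ d)) κ (B.clock B.steps.length) where
  own := own
  time v := B.clock (step v)
  time_mono u v huv := B.clock_mono (h.step_mono huv)
  time_le v := B.clock_mono (h.step_le v)
  send := by
    classical
    intro r τ₀ τ hτ S hS
    let J := (Finset.range B.steps.length).filter fun j => τ₀ ≤ B.clock j ∧ B.clock (j + 1) ≤ τ
    let T : ℕ → Finset (FFTNode a) := fun j => S.filter fun u =>
      ∃ m ∈ (B.stepAt j).msgs, (m.src = r ∧ m.dst ≠ r) ∧ u ∈ m.payload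
    have h1 : S ⊆ J.biUnion T := by
      intro u hu
      obtain ⟨rfl, ht, v, huv, hv, hvt⟩ := hS u hu
      rcases h.mem_of_adj huv with hm | hm
      -- The value leaves its owner in a superstep `j` with `step u ≤ j < step v`, so the time
      -- interval of `j` lies within `[τ₀, τ]`.
      · obtain ⟨j, hj, hsj, m, hm, hmr, hum⟩ := h.exists_sent _ _ (Ne.symm hv) hm
        refine Finset.mem_biUnion.2 ⟨j, Finset.mem_filter.2 ⟨?_, ?_, ?_⟩,
          Finset.mem_filter.2 ⟨hu, m, hm, hmr, hum⟩⟩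
        · exact Finset.mem_range.2 (lt_length hm)
        · exact ht.trans (B.clock_mono hsj)
        · exact (B.clock_mono hj).trans hvt
      · exact absurd hm.1.symm hv
    have h2 : ∀ j, (T j).card ≤ κ * (B.stepAt j).degree := by
      intro j
      refine (card_le_of_payload _ (message_size hκ j) (fun m => m.src = r ∧ m.dst ≠ r) (T j)
        fun u hu => (Finset.mem_filter.1 hu).2).trans (Nat.mul_le_mul_left κ ?_)
      exact (B.stepAt j).sent_le_degree r
    calc S.card ≤ ∑ j ∈ J, (T j).card := (Finset.card_le_card h1).trans Finset.card_biUnion_le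
      _ ≤ ∑ j ∈ J, κ * (B.stepAt j).degree := Finset.sum_le_sum fun j _ => h2 j
      _ = κ * ∑ j ∈ J, (B.stepAt j).degree := (Finset.mul_sum _ _ _).symm
      _ ≤ κ * (τ - τ₀) := by
        gcongr
        have := sum_within_le (fun j => (B.stepAt j).degree) τ₀ τ B.steps.length
        exact this.trans (Nat.sub_le_sub_right (min_le_right _ _) _)
  receive := by
    classical
    intro r S hS
    let T : ℕ → Finset (FFTNode a) := fun j => S.filter fun u =>
      ∃ m ∈ (B.stepAt j).msgs, (m.dst = r ∧ m.src ≠ r) ∧ u ∈ m.payload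
    have h1 : S ⊆ (Finset.range B.steps.length).biUnion T := by
      intro u hu
      obtain ⟨hur, v, huv, rfl⟩ := hS u hu
      rcases h.mem_of_adj huv with hm | hm
      · obtain ⟨j, hj, m, hm, hmr, hum⟩ := h.exists_received hur _ hm
        exact Finset.mem_biUnion.2 ⟨j, Finset.mem_range.2 (lt_length hm),
          Finset.mem_filter.2 ⟨hu, m, hm, hmr, hum⟩⟩
      · exact absurd hm.1 hur
    have h2 : ∀ j, (T j).card ≤ κ * (B.stepAt j).degree := by
      intro j
      refine (card_le_of_payload _ (message_size hκ j) (fun m => m.dst = r ∧ m.src ≠ r) (T j)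
        fun u hu => (Finset.mem_filter.1 hu).2).trans (Nat.mul_le_mul_left κ ?_)
      exact (B.stepAt j).received_le_degree r
    calc S.card ≤ ∑ j ∈ Finset.range B.steps.length, (T j).card :=
          (Finset.card_le_card h1).trans Finset.card_biUnion_le
      _ ≤ ∑ j ∈ Finset.range B.steps.length, κ * (B.stepAt j).degree :=
          Finset.sum_le_sum fun j _ => h2 j
      _ = κ * B.clock B.steps.length := (Finset.mul_sum _ _ _).symm

theorem card_part_le_work {a κ : ℕ} {B : StaticAlg (FFTNode a) d}
    {own : FFTNode a → Fin (2 ^ d)} {step : FFTNode a → ℕ}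
    (h : B.IsPlacement (fftDAG a) own step)
    (hκ : ∀ s ∈ B.steps, ∀ m ∈ s.msgs, m.payload.card ≤ κ) (r : Fin (2 ^ d)) :
    (((h.schedule hκ).part r).filter fun v => (v.2 : ℕ) ≠ 0).card ≤ B.work r := by
  classical
  rw [work, sum_map_eq_sum_range _ Superstep.idle]
  have h1 : (((h.schedule hκ).part r).filter fun v => (v.2 : ℕ) ≠ 0) ⊆
      (Finset.range B.steps.length).biUnion fun i => ((B.stepAt i).comp r).toFinset := by
    intro v hv
    obtain ⟨hv, hl⟩ := Finset.mem_filter.1 hv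
    have hr : own v = r := (h.schedule hκ).mem_part.1 hv
    have hm := h.mem_comp v (mt (isInputNode_iff v).1 hl)
    rw [hr] at hm
    refine Finset.mem_biUnion.2 ⟨step v, Finset.mem_range.2 ?_, Multiset.mem_toFinset.2 hm⟩
    by_contra hc
    rw [B.stepAt_of_le (not_lt.1 hc)] at hm
    exact absurd hm (Multiset.notMem_zero _)
  refine (Finset.card_le_card h1).trans (Finset.card_biUnion_le.trans ?_)
  exact Finset.sum_le_sum fun i _ => Multiset.toFinset_card_le _

end IsPlacement

/-- A legal superstep with label at least `d` has degree `0`, so the charged labels account for the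
whole communication time. -/
theorem Valid.sum_F_eq {G : Digraph V} {B : StaticAlg V d} (h : B.Valid G) :
    ∑ i ∈ Finset.range d, B.F i = B.clock B.steps.length := by
  rw [clock]
  unfold F stepAt
  rw [sum_label_eq, sum_map_eq_sum_range _ Superstep.idle]
  intro s hs
  obtain ⟨i, hi, rfl⟩ := List.getElem_of_mem hs
  have := h.legal i
  rw [stepAt, List.getD_eq_getElem _ _ hi] at this
  exact Superstep.degree_eq_zero this

/-- Every algorithm that evaluates the FFT DAG without recomputation and with balanced work has
communication complexity `Ω((n / p) log n / log (n / p))`. -/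
theorem exists_le_commComplexity {ε : ℝ} (h0 : 0 ≤ ε) (h1 : ε < 1) {κ : ℕ} (hκ : 1 ≤ κ) :
    ∃ δ : ℝ, 0 < δ ∧ ∀ (a d : ℕ) (B : StaticAlg (FFTNode a) d) (σ : ℝ), 0 < a → d ≤ a → 0 ≤ σ →
      IsFFTAlg ε κ B →
      δ * (2 ^ (a - d) * (a / max 1 ((a - d : ℕ) : ℝ))) ≤ B.commComplexity σ := by
  obtain ⟨δ, hδ, h⟩ := Schedule.exists_le_time h0 h1 hκ
  refine ⟨δ, hδ, fun a d B σ ha hd hσ hB => ?_⟩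
  obtain ⟨own, step, hp⟩ := exists_isPlacement hB.valid hB.eval_once hB.input_once
  have h2 := h a d _ (hp.schedule hB.message_size) ha hd fun r =>
    le_trans (by exact_mod_cast hp.card_part_le_work hB.message_size r) (hB.balanced r)
  refine h2.trans ?_
  rw [← hB.valid.sum_F_eq, commComplexity]
  push_cast
  exact Finset.sum_le_sum fun i _ => le_add_of_nonneg_right (by positivity)

end StaticAlg

end Execution

/-! ## Folding -/

section Folding

variable {V : Type} {d : ℕ}

theorem foldPE_val {e : ℕ} (he : e ≤ d) (r : Fin (2 ^ d)) :
    (foldPE e r : ℕ) = (r : ℕ) / 2 ^ (d - e) := by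
  simp only [foldPE, Fin.ofNat]
  apply Nat.mod_eq_of_lt
  rw [Nat.div_lt_iff_lt_mul (by positivity), ← pow_add, Nat.add_sub_cancel' he]
  exact r.isLt

theorem card_fiber_le {e : ℕ} (he : e ≤ d) (j : Fin (2 ^ e)) :
    (Finset.univ.filter fun r : Fin (2 ^ d) => foldPE e r = j).card ≤ 2 ^ (d - e) := by
  have h := Finset.card_le_card_of_injOn (s := Finset.univ.filter fun r : Fin (2 ^ d) =>
    foldPE e r = j) (t := Finset.range (2 ^ (d - e))) (fun r => (r : ℕ) % 2 ^ (d - e)) ?_ ?_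
  · rwa [Finset.card_range] at h
  · intro r _
    exact Finset.mem_coe.2 (Finset.mem_range.2 (Nat.mod_lt _ (by positivity)))
  · intro r hr r' hr' h
    have hr := congrArg Fin.val (Finset.mem_filter.1 hr).2
    have hr' := congrArg Fin.val (Finset.mem_filter.1 hr').2
    rw [foldPE_val he] at hr hr'
    apply Fin.ext
    rw [← Nat.div_add_mod (r : ℕ) (2 ^ (d - e)), ← Nat.div_add_mod (r' : ℕ) (2 ^ (d - e)), hr, hr']
    exact congrArg _ h

theorem SameCluster.fold {e i : ℕ} (he : e ≤ d) {r r' : Fin (2 ^ d)} (h : SameCluster i r r') :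
    SameCluster i (foldPE e r) (foldPE e r') := by
  unfold SameCluster at *
  rw [foldPE_val he, foldPE_val he, Nat.div_div_eq_div_mul, Nat.div_div_eq_div_mul, ← pow_add]
  -- Subtraction is truncated: for `i > e` the left side may exceed `d - i`, and the additional
  -- shift preserves equality.
  have h1 : d - e + (e - i) = (d - i) + (d - e + (e - i) - (d - i)) := by omega
  rw [h1, pow_add, ← Nat.div_div_eq_div_mul, ← Nat.div_div_eq_div_mul, h]

namespace Superstep

/-- The superstep executed by `2 ^ e` processing elements after folding. -/
def fold (e : ℕ) (s : Superstep V d) : Superstep V e where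
  label := s.label
  comp := fun j => ∑ r with foldPE e r = j, s.comp r
  msgs := s.msgs.map fun m => ⟨foldPE e m.src, foldPE e m.dst, m.payload⟩

theorem mem_fold_comp {e : ℕ} {s : Superstep V d} {j : Fin (2 ^ e)} {v : V} :
    v ∈ (s.fold e).comp j ↔ ∃ r, foldPE e r = j ∧ v ∈ s.comp r := by
  simp [fold, Multiset.mem_sum]

/-- Larger memories preserve legality, so it is enough that a folded memory contains those that it
merges; this inclusion is the invariant of `LegalRun.fold`. -/
theorem Legal.fold {e : ℕ} (he : e ≤ d) {G : Digraph V} {M : Fin (2 ^ d) → Set V}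
    {M' : Fin (2 ^ e) → Set V} (hM : ∀ r, M r ⊆ M' (foldPE e r)) {s : Superstep V d}
    (h : s.Legal G M) : (s.fold e).Legal G M' := by
  constructor
  · intro j v hv
    obtain ⟨r, rfl, hv'⟩ := mem_fold_comp.1 hv
    refine ⟨(h.1 r v hv').1, fun u hu => ?_⟩
    rcases (h.1 r v hv').2 u hu with hu | hu
    · exact Or.inl (hM r hu)
    · exact Or.inr (mem_fold_comp.2 ⟨r, rfl, hu⟩)
  · intro m' hm'
    obtain ⟨m, hm, rfl⟩ := Multiset.mem_map.1 hm'
    refine ⟨(h.2 m hm).1.fold he, fun v hv => ?_⟩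
    rcases (h.2 m hm).2 v hv with hv | hv
    · exact Or.inl (hM _ hv)
    · exact Or.inr (mem_fold_comp.2 ⟨_, rfl, hv⟩)

theorem next_subset_fold {e : ℕ} {M : Fin (2 ^ d) → Set V} {M' : Fin (2 ^ e) → Set V}
    (hM : ∀ r, M r ⊆ M' (foldPE e r)) (s : Superstep V d) (r : Fin (2 ^ d)) :
    s.next M r ⊆ (s.fold e).next M' (foldPE e r) := by
  rintro v (hv | hv | ⟨m, hm, rfl, hv⟩)
  · exact Or.inl (hM r hv)
  · exact Or.inr (Or.inl (mem_fold_comp.2 ⟨r, rfl, hv⟩))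
  · exact Or.inr (Or.inr ⟨_, Multiset.mem_map_of_mem _ hm, rfl, hv⟩)

theorem card_filter_fold_le {e c : ℕ} (he : e ≤ d) (ms : Multiset (Message V d))
    (g : Message V d → Fin (2 ^ d)) (hg : ∀ r, (ms.filter fun m => g m = r).card ≤ c)
    (j : Fin (2 ^ e)) : (ms.filter fun m => foldPE e (g m) = j).card ≤ 2 ^ (d - e) * c := by
  have h1 := Multiset.sum_count_eq_card
    (s := Finset.univ.filter fun r : Fin (2 ^ d) => foldPE e r = j)
    (m := (ms.filter fun m => foldPE e (g m) = j).map g) (by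
      intro r hr
      obtain ⟨m, hm, rfl⟩ := Multiset.mem_map.1 hr
      exact Finset.mem_filter.2 ⟨Finset.mem_univ _, (Multiset.mem_filter.1 hm).2⟩)
  rw [Multiset.card_map] at h1
  rw [← h1]
  refine (Finset.sum_le_card_nsmul _ _ c fun r _ => ?_).trans
    (by rw [smul_eq_mul]; exact Nat.mul_le_mul_right c (card_fiber_le he j))
  rw [Multiset.count_map]
  refine (Multiset.card_le_card (Multiset.filter_le_filter _ (Multiset.filter_le _ _))).trans ?_
  simpa only [eq_comm] using hg r

theorem degree_fold_le {e c : ℕ} (he : e ≤ d) (s : Superstep V d)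
    (hs : ∀ r, (s.msgs.filter fun m => m.src = r).card ≤ c)
    (hr : ∀ r, (s.msgs.filter fun m => m.dst = r).card ≤ c) :
    (s.fold e).degree ≤ 2 ^ (d - e) * c := by
  apply Finset.sup_le
  intro j _
  apply max_le
  · rw [sent, fold, Multiset.filter_map, Multiset.card_map]
    refine le_trans (Multiset.card_le_card ?_) (card_filter_fold_le he s.msgs _ hs j)
    exact Multiset.monotone_filter_right _ fun m hm => hm.1
  · rw [received, fold, Multiset.filter_map, Multiset.card_map]
    refine le_trans (Multiset.card_le_card ?_) (card_filter_fold_le he s.msgs _ hr j)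
    exact Multiset.monotone_filter_right _ fun m hm => hm.1

end Superstep

namespace StaticAlg

theorem fold_steps (e : ℕ) (B : StaticAlg V d) :
    (B.fold e).steps = B.steps.map (Superstep.fold e) := rfl

theorem LegalRun.fold {e : ℕ} (he : e ≤ d) {G : Digraph V} {ss : List (Superstep V d)} :
    ∀ {M : Fin (2 ^ d) → Set V} {M' : Fin (2 ^ e) → Set V}, (∀ r, M r ⊆ M' (foldPE e r)) →
      LegalRun G M ss → LegalRun G M' (ss.map (Superstep.fold e)) := by
  induction ss with
  | nil => exact fun _ _ => trivial
  | cons s ss ih => exact fun hM h => ⟨h.1.fold he hM, ih (Superstep.next_subset_fold hM s) h.2⟩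

theorem Valid.fold {e : ℕ} (he : e ≤ d) {G : Digraph V} {B : StaticAlg V d} (h : B.Valid G) :
    (B.fold e).Valid G := by
  have hmem : ∀ j v, v ∈ (B.fold e).init j ↔ ∃ r, foldPE e r = j ∧ v ∈ B.init r := by
    simp [StaticAlg.fold, Multiset.mem_sum]
  constructor
  · intro j v hv
    obtain ⟨r, -, hv⟩ := (hmem j v).1 hv
    exact h.1 r v hv
  · exact LegalRun.fold he (fun r v hv => (hmem _ v).2 ⟨r, rfl, hv⟩) h.2

theorem sum_fold_count [DecidableEq V] (e : ℕ) (f : Fin (2 ^ d) → Multiset V) (v : V) :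
    ∑ j : Fin (2 ^ e), (∑ r with foldPE e r = j, f r).count v = ∑ r, (f r).count v := by
  rw [← Finset.sum_fiberwise Finset.univ (foldPE e) fun r => (f r).count v]
  exact Finset.sum_congr rfl fun j _ => Multiset.count_sum'

theorem initCount_fold [DecidableEq V] (e : ℕ) (B : StaticAlg V d) (v : V) :
    (B.fold e).initCount v = B.initCount v := sum_fold_count e B.init v

theorem evalCount_fold [DecidableEq V] (e : ℕ) (B : StaticAlg V d) (v : V) :
    (B.fold e).evalCount v = B.evalCount v := by
  rw [evalCount, evalCount, fold_steps, List.map_map]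
  congr 1
  exact List.map_congr_left fun s _ => sum_fold_count e s.comp v

theorem work_fold (e : ℕ) (B : StaticAlg V d) (j : Fin (2 ^ e)) :
    (B.fold e).work j = ∑ r with foldPE e r = j, B.work r := by
  unfold work
  rw [fold_steps, List.map_map]
  induction B.steps with
  | nil => simp
  | cons s ss ih =>
    simp only [List.map_cons, List.sum_cons, ih, Finset.sum_add_distrib]
    congr 1
    exact (Multiset.card_sum (Finset.univ.filter fun r => foldPE e r = j) s.comp :)

theorem work_fold_le {e w : ℕ} (he : e ≤ d) {B : StaticAlg V d} (hw : ∀ r, B.work r ≤ w)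
    (j : Fin (2 ^ e)) : (B.fold e).work j ≤ 2 ^ (d - e) * w := by
  rw [work_fold]
  refine (Finset.sum_le_card_nsmul _ _ w fun r _ => hw r).trans ?_
  rw [smul_eq_mul]
  exact Nat.mul_le_mul_right w (card_fiber_le he j)

theorem S_fold (e : ℕ) (B : StaticAlg V d) (i : ℕ) : (B.fold e).S i = B.S i := by
  rw [S, S, fold_steps, List.filter_map, List.length_map]
  rfl

theorem F_fold (e : ℕ) (B : StaticAlg V d) (i : ℕ) : (B.fold e).F i =
    ((B.steps.filter (fun s => s.label = i)).map fun s => (s.fold e).degree).sum := by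
  rw [F, fold_steps, List.filter_map, List.map_map]
  rfl

theorem F_fold_le {e D : ℕ} {B : StaticAlg V d} (h : ∀ s ∈ B.steps, (s.fold e).degree ≤ D)
    (i : ℕ) : (B.fold e).F i ≤ B.S i * D := by
  rw [F_fold, S]
  refine (List.sum_le_card_nsmul _ D ?_).trans (by simp)
  intro x hx
  obtain ⟨s, hs, rfl⟩ := List.mem_map.1 hx
  exact h s (List.mem_filter.1 hs).1

theorem le_F_fold {e D i : ℕ} {B : StaticAlg V d}
    (h : ∀ s ∈ B.steps, s.label = i → D ≤ (s.fold e).degree) : B.S i * D ≤ (B.fold e).F i := by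
  rw [F_fold, S]
  refine le_trans (by simp) (List.card_nsmul_le_sum _ D ?_)
  intro x hx
  obtain ⟨s, hs, rfl⟩ := List.mem_map.1 hx
  obtain ⟨h1, h2⟩ := List.mem_filter.1 hs
  exact h s h1 (by simpa using h2)

theorem sum_S_eq (B : StaticAlg V d) (e : ℕ) :
    ∑ i ∈ Finset.range e, B.S i = (B.steps.filter fun s => s.label < e).length := by
  unfold S
  induction B.steps with
  | nil => simp
  | cons s ss ih =>
    have e1 : ∀ i, ((s :: ss).filter (fun s => s.label = i)).length =
        (if s.label = i then 1 else 0) + (ss.filter (fun s => s.label = i)).length := by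
      intro i
      by_cases hi : s.label = i <;> simp [hi, add_comm]
    rw [Finset.sum_congr rfl fun i _ => e1 i, Finset.sum_add_distrib, Finset.sum_ite_eq, ih]
    by_cases hs : s.label < e <;> simp [hs, add_comm]

end StaticAlg

/-- Folding preserves everything except the balance, whose constant may therefore change. -/
theorem IsFFTAlg.fold {ε ε' : ℝ} {κ a e : ℕ} (he : e ≤ d) {B : StaticAlg (FFTNode a) d}
    (h : IsFFTAlg ε' κ B) (hbal : ∀ j, ((B.fold e).work j : ℝ) ≤ ε * (2 ^ a * a)) :
    IsFFTAlg ε κ (B.fold e) where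
  valid := h.valid.fold he
  message_size := by
    intro s' hs' m' hm'
    rw [StaticAlg.fold_steps] at hs'
    obtain ⟨s, hs, rfl⟩ := List.mem_map.1 hs'
    obtain ⟨m, hm, rfl⟩ := Multiset.mem_map.1 hm'
    exact h.message_size s hs m hm
  eval_once v hv := by rw [B.evalCount_fold]; exact h.eval_once v hv
  input_once v hv := by rw [B.initCount_fold]; exact h.input_once v hv
  balanced := hbal

/-- Folding an algorithm with evenly distributed work yields a member of the class. -/
theorem IsFFTAlg.fold_mem_FFTClass {ε ε' : ℝ} {κ a e : ℕ} (hε : 1 / 2 ≤ ε) (he : e ≤ a)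
    (he1 : 1 ≤ e) {B : StaticAlg (FFTNode a) a} (h : IsFFTAlg ε' κ B) (hw : ∀ r, B.work r ≤ a) :
    B.fold e ∈ FFTClass ε κ a e := by
  have hb : ∀ e', 1 ≤ e' → e' ≤ a → ((2 ^ (a - e') * a : ℕ) : ℝ) ≤ ε * (2 ^ a * a) := by
    intro e' h1 h2
    -- At least two processors remain, so each has at most half of the work, and `ε ≥ 1/2`.
    have h3 : 2 * 2 ^ (a - e') ≤ 2 ^ a := by
      rw [← pow_succ']
      exact Nat.pow_le_pow_right (by norm_num) (by omega)
    have h4 : 2 * (2 : ℝ) ^ (a - e') ≤ 2 ^ a := by exact_mod_cast h3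
    have h5 : (2 : ℝ) ^ (a - e') ≤ ε * 2 ^ a := by
      have := mul_le_mul_of_nonneg_right hε (show (0 : ℝ) ≤ 2 ^ a by positivity)
      linarith
    push_cast
    rw [← mul_assoc]
    gcongr
  have h1 : IsFFTAlg ε κ (B.fold e) := h.fold he fun j =>
    le_trans (by exact_mod_cast StaticAlg.work_fold_le he hw j) (hb e he1 he)
  refine ⟨h1, fun e' he' hlt => h1.fold hlt.le fun j => ?_⟩
  -- Only the work bound has to be composed; that folding twice equals folding once is not needed.
  have h2 := StaticAlg.work_fold_le hlt.le (StaticAlg.work_fold_le he hw) j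
  rw [← mul_assoc, ← pow_add, show e - e' + (a - e) = a - e' by omega] at h2
  exact le_trans (by exact_mod_cast h2) (hb e' he' (by omega))

end Folding

/-! ## Correctness of the recursive algorithm -/

namespace RecFFT

variable {a : ℕ}

/-- The effect of the transposition of a `2 ^ j × 2 ^ j` matrix on the positions of index bits. -/
def swapBit (j i : ℕ) : ℕ := if i < j then i + j else if i < 2 * j then i - j else i

theorem swapBit_swapBit (j i : ℕ) : swapBit j (swapBit j i) = i := by
  unfold swapBit
  split_ifs <;> omega

theorem vp_val {x : ℕ} (h : x < 2 ^ a) : (vp x : Fin (2 ^ a)).val = x := Nat.mod_eq_of_lt h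

theorem transpose_testBit {j : ℕ} (hj : 2 * j ≤ a) (r : Fin (2 ^ a)) (i : ℕ) :
    (transpose (2 ^ j) r : ℕ).testBit i = (r : ℕ).testBit (swapBit j i) := by
  have hlt : 2 ^ j * ((r : ℕ) % 2 ^ j) + (r : ℕ) / 2 ^ j % 2 ^ j < 2 ^ (2 * j) := by
    have h1 : (r : ℕ) % 2 ^ j < 2 ^ j := Nat.mod_lt _ (by positivity)
    have h2 : (r : ℕ) / 2 ^ j % 2 ^ j < 2 ^ j := Nat.mod_lt _ (by positivity)
    have h3 := Nat.mul_le_mul_left (2 ^ j) (Nat.succ_le_of_lt h1)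
    rw [Nat.mul_succ] at h3
    rw [two_mul, pow_add]
    omega
  have hb : ∀ i, (2 ^ (2 * j) * ((r : ℕ) / 2 ^ (2 * j)) +
      (2 ^ j * ((r : ℕ) % 2 ^ j) + (r : ℕ) / 2 ^ j % 2 ^ j)).testBit i =
        (r : ℕ).testBit (swapBit j i) := by
    intro i
    rw [Nat.testBit_two_pow_mul_add _ hlt,
      Nat.testBit_two_pow_mul_add _ (Nat.mod_lt _ (by positivity))]
    simp only [Nat.testBit_mod_two_pow, Nat.testBit_div_two_pow, swapBit]
    by_cases h1 : i < j
    · simp [h1, show i < 2 * j by omega]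
    · by_cases h2 : i < 2 * j
      · simp [h1, h2, show i - j < j by omega]
      · simp [h1, h2, show i - 2 * j + 2 * j = i by omega]
  have hx : (r : ℕ) / (2 ^ j * 2 ^ j) * (2 ^ j * 2 ^ j) + (r : ℕ) % 2 ^ j * 2 ^ j +
      (r : ℕ) / 2 ^ j % 2 ^ j = 2 ^ (2 * j) * ((r : ℕ) / 2 ^ (2 * j)) +
      (2 ^ j * ((r : ℕ) % 2 ^ j) + (r : ℕ) / 2 ^ j % 2 ^ j) := by
    rw [two_mul, pow_add]; ring
  rw [transpose, hx, vp_val]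
  · exact hb i
  · apply Nat.lt_pow_two_of_testBit
    intro i hi
    rw [hb]
    have h1 : swapBit j i = i := by
      unfold swapBit
      split_ifs <;> omega
    rw [h1]
    exact Nat.testBit_lt_two_pow (r.isLt.trans_le (Nat.pow_le_pow_right (by norm_num) hi))

theorem transpose_transpose {j : ℕ} (hj : 2 * j ≤ a) (r : Fin (2 ^ a)) :
    transpose (2 ^ j) (transpose (2 ^ j) r) = r :=
  fin_eq_of_testBit fun i => by
    rw [transpose_testBit hj, transpose_testBit hj, swapBit_swapBit]

theorem transpose_bijective {j : ℕ} (hj : 2 * j ≤ a) :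
    Function.Bijective (transpose (2 ^ j) : Fin (2 ^ a) → Fin (2 ^ a)) :=
  Function.Involutive.bijective (transpose_transpose hj)

/-- Transposition permutes the positions of the index bits, hence carries the flip of bit `t` to
that of its new position. -/
theorem transpose_flipCol {j t : ℕ} (hj : 2 * j ≤ a) (ht : t < a) (r : Fin (2 ^ a)) :
    transpose (2 ^ j) (flipCol r t) = flipCol (transpose (2 ^ j) r) (swapBit j t) := by
  have hs : swapBit j t < a := by
    unfold swapBit
    split_ifs <;> omega
  apply fin_eq_of_testBit
  intro i
  rw [transpose_testBit hj, flipCol_testBit ht, flipCol_testBit hs, transpose_testBit hj]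
  congr 1
  rw [decide_eq_decide]
  constructor
  · rintro rfl
    exact swapBit_swapBit j i
  · rintro rfl
    exact (swapBit_swapBit j t).symm

theorem two_mul_two_pow_le {k : ℕ} (h : 2 ^ (k + 1) ≤ a) : 2 * 2 ^ k ≤ a := by
  rwa [pow_succ'] at h

/-- The data movement acts on positions and does not depend on which columns are stored there. -/
theorem arrange_eq_comp (k : ℕ) : ∀ col : Fin (2 ^ a) → Fin (2 ^ a),
    arrange k col = col ∘ arrange k id := by
  induction k with
  | zero => exact fun _ => rfl
  | succ k ih =>
    intro col
    rw [arrange, arrange, ih, ih col, ih (arrange k id ∘ _)]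
    rfl

theorem arrange_id_bijective (k : ℕ) : 2 ^ k ≤ a →
    Function.Bijective (arrange k (id : Fin (2 ^ a) → Fin (2 ^ a))) := by
  induction k with
  | zero => exact fun _ => Function.bijective_id
  | succ k ih =>
    intro hk
    have hk' := two_mul_two_pow_le hk
    have h := ih (by omega)
    rw [arrange, arrange_eq_comp]
    exact (h.comp (transpose_bijective hk')).comp h

/-- The supersteps inside segments of `2 ^ 2 ^ k` processors rearrange only the lowest `2 ^ k` index
bits. -/
theorem arrange_id_flipCol (k : ℕ) : 2 ^ k ≤ a → ∀ (r : Fin (2 ^ a)) (s : ℕ), 2 ^ k ≤ s → s < a →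
    arrange k id (flipCol r s) = flipCol (arrange k id r) s := by
  induction k with
  | zero => exact fun _ _ _ _ _ => rfl
  | succ k ih =>
    intro hk r s hs hsa
    have hk' := two_mul_two_pow_le hk
    rw [pow_succ'] at hs
    have hsw : swapBit (2 ^ k) s = s := by
      unfold swapBit
      split_ifs <;> omega
    rw [arrange, arrange_eq_comp]
    simp only [Function.comp_apply]
    rw [ih (by omega) r s (by omega) hsa, transpose_flipCol hk' hsa, hsw,
      ih (by omega) _ s (by omega) hsa]

/-- In the arrangement `col`, every segment of `2 ^ 2 ^ k` processors holds the columns of a subDAG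
that starts at level `l`. -/
structure IsArrangement (k l : ℕ) (col : Fin (2 ^ a) → Fin (2 ^ a)) : Prop where
  bijective : Function.Bijective col
  flip : ∀ r, ∀ t < 2 ^ k, col (flipCol r t) = flipCol (col r) (l + t)

theorem IsArrangement.first {k l : ℕ} {col : Fin (2 ^ a) → Fin (2 ^ a)}
    (h : IsArrangement (k + 1) l col) : IsArrangement k l col :=
  ⟨h.bijective, fun r t ht => h.flip r t (by rw [pow_succ]; omega)⟩

/-- The transposition turns a flip of bit `t` into one of bit `t + 2 ^ k`, which the first half left
in place and which `col` maps to bit `l + 2 ^ k + t` of the column. -/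
theorem IsArrangement.second {k l : ℕ} {col : Fin (2 ^ a) → Fin (2 ^ a)}
    (h : IsArrangement (k + 1) l col) (hl : l + 2 ^ (k + 1) ≤ a) :
    IsArrangement k (l + 2 ^ k) (arrange k col ∘ transpose (2 ^ 2 ^ k)) := by
  have hk : 2 * 2 ^ k ≤ a := two_mul_two_pow_le (by omega)
  have hk2 : 2 ^ (k + 1) = 2 * 2 ^ k := pow_succ' 2 k
  rw [arrange_eq_comp]
  refine ⟨(h.bijective.comp (arrange_id_bijective k (by omega))).comp (transpose_bijective hk),
    fun r t ht => ?_⟩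
  have hsw : swapBit (2 ^ k) t = t + 2 ^ k := if_pos ht
  simp only [Function.comp_apply]
  rw [transpose_flipCol hk (by omega), hsw, arrange_id_flipCol k (by omega) _ _ (by omega)
    (by omega), h.flip _ _ (by omega)]
  congr 1
  omega

theorem isArrangement_id {k : ℕ} : IsArrangement k 0 (id : Fin (2 ^ a) → Fin (2 ^ a)) :=
  ⟨Function.bijective_id, fun r t _ => by simp⟩

theorem mem_dummies {m : ℕ} {x : Message (FFTNode a) a} :
    x ∈ dummies m ↔ ∃ j < m / 2, x = ⟨vp j, vp (j + m / 2), ∅⟩ := by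
  simp [dummies, eq_comm]

theorem two_pow_half {b : ℕ} (hb : 1 ≤ b) : 2 ^ b / 2 + 2 ^ b / 2 = 2 ^ b := by
  obtain ⟨c, rfl⟩ := Nat.exists_eq_add_of_le hb
  rw [Nat.add_comm 1 c, pow_succ]
  omega

theorem sameCluster_of_mem_dummies {b : ℕ} (hb : 1 ≤ b) (hba : b ≤ a)
    {x : Message (FFTNode a) a} (hx : x ∈ dummies (2 ^ b)) : SameCluster (a - b) x.src x.dst := by
  obtain ⟨j, hj, rfl⟩ := mem_dummies.1 hx
  have h1 := two_pow_half hb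
  have h2 : 2 ^ b ≤ 2 ^ a := Nat.pow_le_pow_right (by norm_num) hba
  simp only [SameCluster]
  rw [vp_val (by omega), vp_val (by omega), Nat.sub_sub_self hba, Nat.div_eq_of_lt (by omega),
    Nat.div_eq_of_lt (by omega)]

theorem sameCluster_of_testBit {b : ℕ} (hba : b ≤ a) {r r' : Fin (2 ^ a)}
    (h : ∀ i, b ≤ i → (r : ℕ).testBit i = (r' : ℕ).testBit i) : SameCluster (a - b) r r' := by
  rw [SameCluster, Nat.sub_sub_self hba]
  apply Nat.eq_of_testBit_eq
  intro i
  rw [Nat.testBit_div_two_pow, Nat.testBit_div_two_pow]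
  exact h _ (Nat.le_add_left _ _)

theorem mem_commStep_msgs {b l : ℕ} {col f : Fin (2 ^ a) → Fin (2 ^ a)}
    {x : Message (FFTNode a) a} : x ∈ (commStep b l col f).msgs ↔
      (∃ r, x = ⟨r, f r, {node (col r) l}⟩) ∨ x ∈ dummies (2 ^ b) := by
  simp [commStep, eq_comm]

theorem commStep_legal {G : Digraph (FFTNode a)} {b l : ℕ} (hb : 1 ≤ b) (hba : b ≤ a)
    {col f : Fin (2 ^ a) → Fin (2 ^ a)} (hf : ∀ r, SameCluster (a - b) r (f r))
    {M : Fin (2 ^ a) → Set (FFTNode a)} (hM : ∀ r, node (col r) l ∈ M r) :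
    (commStep b l col f).Legal G M := by
  constructor
  · intro r v hv
    exact absurd hv (Multiset.notMem_zero _)
  · intro x hx
    rcases mem_commStep_msgs.1 hx with ⟨r, rfl⟩ | hx
    · refine ⟨hf r, fun v hv => Or.inl ?_⟩
      rw [Finset.mem_singleton.1 hv]
      exact hM r
    · refine ⟨sameCluster_of_mem_dummies hb hba hx, fun v hv => ?_⟩
      obtain ⟨j, -, rfl⟩ := mem_dummies.1 hx
      exact absurd hv (Finset.notMem_empty _)

theorem commStep_next {b l : ℕ} {col f : Fin (2 ^ a) → Fin (2 ^ a)}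
    {M : Fin (2 ^ a) → Set (FFTNode a)} (r : Fin (2 ^ a)) :
    node (col r) l ∈ (commStep b l col f).next M (f r) :=
  Or.inr (Or.inr ⟨_, mem_commStep_msgs.2 (Or.inl ⟨r, rfl⟩), rfl, Finset.mem_singleton_self _⟩)

theorem compStep_legal {l : ℕ} (hl : l < a) {col : Fin (2 ^ a) → Fin (2 ^ a)}
    {M : Fin (2 ^ a) → Set (FFTNode a)} (h1 : ∀ r, node (col r) l ∈ M r)
    (h2 : ∀ r, node (flipCol (col r) l) l ∈ M r) :
    (compStep l col).Legal (fftDAG a) M := by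
  constructor
  · intro r v hv
    rw [Multiset.mem_singleton.1 hv]
    refine ⟨?_, fun u hu => Or.inl ?_⟩
    · rw [isInputNode_iff, node_level hl]
      omega
    · obtain ⟨h3, h4⟩ := (adj_iff _ _).1 hu
      rw [node_level hl] at h3
      have h5 : (u.2 : ℕ) = l := by omega
      rw [eq_node u, h5]
      rw [h5] at h4
      rcases h4 with h4 | h4
      · rw [← h4]; exact h1 r
      · have h6 : u.1 = flipCol (col r) l := by
          rw [show col r = flipCol u.1 l from h4, flipCol_flipCol hl]
        rw [h6]; exact h2 r
  · intro x hx
    have hx : x ∈ dummies (2 ^ 1) := hx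
    refine ⟨sameCluster_of_mem_dummies le_rfl (by omega) hx, fun v hv => ?_⟩
    obtain ⟨j, -, rfl⟩ := mem_dummies.1 hx
    exact absurd hv (Finset.notMem_empty _)

end RecFFT

/-! ### Execution of the recursive algorithm: legality, counts and message bounds -/

section Run

variable {V : Type} {d : ℕ}

/-- The local memories after a sequence of supersteps. -/
def memoryAfter (M : Fin (2 ^ d) → Set V) (ss : List (Superstep V d)) : Fin (2 ^ d) → Set V :=
  ss.foldl Superstep.next M

theorem legalRun_append {G : Digraph V} {ss ss' : List (Superstep V d)} :
    ∀ {M : Fin (2 ^ d) → Set V}, StaticAlg.LegalRun G M ss →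
      StaticAlg.LegalRun G (memoryAfter M ss) ss' → StaticAlg.LegalRun G M (ss ++ ss') := by
  induction ss with
  | nil => exact fun _ h => h
  | cons s ss ih => exact fun h h' => ⟨h.1, ih h.2 h'⟩

theorem memoryAfter_append (M : Fin (2 ^ d) → Set V) (ss ss' : List (Superstep V d)) :
    memoryAfter M (ss ++ ss') = memoryAfter (memoryAfter M ss) ss' := List.foldl_append

end Run

namespace RecFFT

variable {a : ℕ}

theorem sameCluster_transpose {k : ℕ} (hk : 2 ^ (k + 1) ≤ a) (r : Fin (2 ^ a)) :
    SameCluster (a - 2 ^ (k + 1)) r (transpose (2 ^ 2 ^ k) r) := by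
  apply sameCluster_of_testBit hk
  intro i hi
  rw [pow_succ'] at hi
  rw [transpose_testBit (two_mul_two_pow_le hk)]
  congr 1
  unfold swapBit
  split_ifs <;> omega

theorem sameCluster_flipCol (ha : 1 ≤ a) (r : Fin (2 ^ a)) :
    SameCluster (a - 1) r (flipCol r 0) := by
  apply sameCluster_of_testBit ha
  intro i hi
  rw [flipCol_testBit (by omega), decide_eq_false (by omega), Bool.xor_false]

/-- The invariant is that every processor holds its current column's value at the current level.
Since transposition is an involution, `r` receives the value from `transpose r`, as the new
arrangement prescribes. -/
theorem steps_legalRun (k : ℕ) : ∀ (l : ℕ) (col : Fin (2 ^ a) → Fin (2 ^ a))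
    (M : Fin (2 ^ a) → Set (FFTNode a)), l + 2 ^ k ≤ a → IsArrangement k l col →
    (∀ r, node (col r) l ∈ M r) → StaticAlg.LegalRun (fftDAG a) M (steps k l col) ∧
      ∀ r, node (arrange k col r) (l + 2 ^ k) ∈ memoryAfter M (steps k l col) r := by
  induction k with
  | zero =>
    intro l col M hl hcol hM
    have hl' : l < a := by simpa using hl
    refine ⟨⟨commStep_legal le_rfl (by omega) (sameCluster_flipCol (by omega)) hM,
      compStep_legal hl' (fun r => Or.inl (hM r)) fun r => ?_, trivial⟩, fun r => ?_⟩
    · have h := hcol.flip r 0 (by norm_num)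
      rw [add_zero] at h
      rw [← h]
      have h2 := commStep_next (b := 1) (l := l) (col := col) (f := fun r => flipCol r 0) (M := M)
        (flipCol r 0)
      simp only [flipCol_flipCol (show 0 < a by omega)] at h2
      exact h2
    · exact Or.inr (Or.inl (Multiset.mem_singleton_self _))
  | succ k ih =>
    intro l col M hl hcol hM
    have hk2 : 2 ^ (k + 1) = 2 ^ k + 2 ^ k := by rw [pow_succ]; omega
    have hka : 2 ^ (k + 1) ≤ a := by omega
    have hk0 : 0 < 2 ^ k := by positivity
    obtain ⟨h1, h2⟩ := ih l col M (by omega) hcol.first hM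
    set M1 := memoryAfter M (steps k l col)
    have hT := transpose_transpose (two_mul_two_pow_le hka)
    have h3 : ∀ r, node ((arrange k col ∘ transpose (2 ^ 2 ^ k)) r) (l + 2 ^ k) ∈
        (commStep (2 ^ (k + 1)) (l + 2 ^ k) (arrange k col)
          (transpose (2 ^ 2 ^ k))).next M1 r := by
      intro r
      have := commStep_next (b := 2 ^ (k + 1)) (l := l + 2 ^ k) (col := arrange k col)
        (f := transpose (2 ^ 2 ^ k)) (M := M1) (transpose (2 ^ 2 ^ k) r)
      rw [hT] at this
      exact this
    obtain ⟨h4, h5⟩ := ih (l + 2 ^ k) _ _ (by omega) (hcol.second hl) h3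
    constructor
    · exact legalRun_append h1 ⟨commStep_legal (Nat.one_le_two_pow) hka
        (sameCluster_transpose hka) h2, h4⟩
    · intro r
      have := h5 r
      rw [add_assoc, ← hk2] at this
      rw [steps, memoryAfter_append]
      exact this

theorem alg_valid (k : ℕ) : (alg k).Valid (fftDAG (2 ^ k)) := by
  constructor
  · intro r v hv
    rw [Multiset.mem_singleton.1 hv, isInputNode_iff, node_level (Nat.zero_le _)]
  · exact (steps_legalRun k 0 id _ (by simp) isArrangement_id
      fun r => Multiset.mem_singleton_self _).1

theorem sum_count_node {l : ℕ} (hl : l ≤ a) {col : Fin (2 ^ a) → Fin (2 ^ a)}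
    (hcol : Function.Bijective col) (v : FFTNode a) :
    ∑ r, Multiset.count v {node (col r) l} = if (v.2 : ℕ) = l then 1 else 0 := by
  simp only [Multiset.count_singleton]
  split_ifs with h
  · obtain ⟨r, hr⟩ := hcol.2 v.1
    rw [Finset.sum_eq_single r]
    · rw [if_pos]
      rw [hr, ← h]
      exact eq_node v
    · intro r' _ hne
      rw [if_neg]
      intro hc
      exact hne (hcol.1 (hr.trans (congrArg Prod.fst hc)).symm)
    · exact fun h => absurd (Finset.mem_univ _) h
  · apply Finset.sum_eq_zero
    intro r _
    rw [if_neg]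
    intro hc
    apply h
    rw [hc, node_level hl]

theorem steps_evalCount (k : ℕ) (v : FFTNode a) : ∀ (l : ℕ) (col : Fin (2 ^ a) → Fin (2 ^ a)),
    l + 2 ^ k ≤ a → IsArrangement k l col →
    ((steps k l col).map fun s => ∑ r, (s.comp r).count v).sum =
      if l < (v.2 : ℕ) ∧ (v.2 : ℕ) ≤ l + 2 ^ k then 1 else 0 := by
  induction k with
  | zero =>
    intro l col hl hcol
    have h := sum_count_node (l := l + 1) (by simpa using hl) hcol.bijective v
    simp only [steps, commStep, compStep, List.map_cons, List.map_nil, List.sum_cons, List.sum_nil,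
      Multiset.count_zero, Finset.sum_const_zero, zero_add, add_zero, h, pow_zero]
    congr 1
    apply propext
    omega
  | succ k ih =>
    intro l col hl hcol
    have hk2 : 2 ^ (k + 1) = 2 ^ k + 2 ^ k := by rw [pow_succ]; omega
    have hk0 : 0 < 2 ^ k := by positivity
    simp only [steps, List.map_append, List.map_cons, List.sum_append, List.sum_cons]
    rw [ih l col (by omega) hcol.first, ih (l + 2 ^ k) _ (by omega) (hcol.second hl)]
    simp only [commStep, Multiset.count_zero, Finset.sum_const_zero, zero_add]
    split_ifs <;> omega

theorem alg_work (k : ℕ) (r : Fin (2 ^ 2 ^ k)) : (alg k).work r = 2 ^ k := by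
  have h : ∀ (k' l : ℕ) (col : Fin (2 ^ 2 ^ k) → Fin (2 ^ 2 ^ k)),
      ((steps k' l col).map fun s => (s.comp r).card).sum = 2 ^ k' := by
    intro k'
    induction k' with
    | zero => exact fun l col => by simp [steps, commStep, compStep]
    | succ k' ih =>
      intro l col
      simp only [steps, List.map_append, List.map_cons, List.sum_append, List.sum_cons, ih]
      simp only [commStep, Multiset.card_zero]
      rw [pow_succ]; omega
  exact h k 0 id

/-- What the supersteps of the algorithm have in common. -/
structure IsRegular (s : Superstep (FFTNode a) a) : Prop where
  exists_label : ∃ b, 1 ≤ b ∧ b ≤ a ∧ s.label = a - b ∧ dummies (2 ^ b) ≤ s.msgs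
  src_le : ∀ r, (s.msgs.filter fun m => m.src = r).card ≤ 2
  dst_le : ∀ r, (s.msgs.filter fun m => m.dst = r).card ≤ 2
  payload_le : ∀ m ∈ s.msgs, m.payload.card ≤ 1

theorem card_filter_map_le_one {α : Type} {ms : Multiset α} (hn : ms.Nodup)
    {g : α → Message (FFTNode a) a} {h : Message (FFTNode a) a → Fin (2 ^ a)}
    (hinj : ∀ x ∈ ms, ∀ y ∈ ms, h (g x) = h (g y) → x = y) (r : Fin (2 ^ a)) :
    ((ms.map g).filter fun m => h m = r).card ≤ 1 := by
  rw [Multiset.filter_map, Multiset.card_map]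
  refine (Finset.card_le_one (s := ⟨_, hn.filter _⟩)).2 ?_
  intro x hx y hy
  obtain ⟨h1, h2⟩ := Multiset.mem_filter.1 hx
  obtain ⟨h3, h4⟩ := Multiset.mem_filter.1 hy
  exact hinj x h1 y h3 (h2.trans h4.symm)

theorem card_dummies_src {b : ℕ} (hb : 1 ≤ b) (hba : b ≤ a) (r : Fin (2 ^ a)) :
    ((dummies (2 ^ b)).filter fun m : Message (FFTNode a) a => m.src = r).card ≤ 1 := by
  apply card_filter_map_le_one (Multiset.nodup_range _)
  intro x hx y hy h
  have h1 := two_pow_half hb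
  have h2 : 2 ^ b ≤ 2 ^ a := Nat.pow_le_pow_right (by norm_num) hba
  rw [Multiset.mem_range] at hx hy
  have h3 := congrArg Fin.val h
  simp only at h3
  rw [vp_val (by omega), vp_val (by omega)] at h3
  exact h3

theorem card_dummies_dst {b : ℕ} (hb : 1 ≤ b) (hba : b ≤ a) (r : Fin (2 ^ a)) :
    ((dummies (2 ^ b)).filter fun m : Message (FFTNode a) a => m.dst = r).card ≤ 1 := by
  apply card_filter_map_le_one (Multiset.nodup_range _)
  intro x hx y hy h
  have h1 := two_pow_half hb
  have h2 : 2 ^ b ≤ 2 ^ a := Nat.pow_le_pow_right (by norm_num) hba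
  rw [Multiset.mem_range] at hx hy
  have h3 := congrArg Fin.val h
  simp only at h3
  rw [vp_val (by omega), vp_val (by omega)] at h3
  omega

theorem payload_of_mem_dummies {m : ℕ} {x : Message (FFTNode a) a} (hx : x ∈ dummies m) :
    x.payload.card ≤ 1 := by
  obtain ⟨j, -, rfl⟩ := mem_dummies.1 hx
  simp

theorem commStep_isRegular {b l : ℕ} (hb : 1 ≤ b) (hba : b ≤ a)
    {col f : Fin (2 ^ a) → Fin (2 ^ a)} (hf : Function.Injective f) :
    IsRegular (commStep b l col f) where
  exists_label := ⟨b, hb, hba, rfl, Multiset.le_add_left _ _⟩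
  src_le r := by
    rw [commStep, Multiset.filter_add, Multiset.card_add]
    exact Nat.add_le_add (card_filter_map_le_one Finset.univ.nodup (fun x _ y _ h => h) r)
      (card_dummies_src hb hba r)
  dst_le r := by
    rw [commStep, Multiset.filter_add, Multiset.card_add]
    exact Nat.add_le_add (card_filter_map_le_one Finset.univ.nodup (fun x _ y _ h => hf h) r)
      (card_dummies_dst hb hba r)
  payload_le m hm := by
    rcases mem_commStep_msgs.1 hm with ⟨r, rfl⟩ | hm
    · simp
    · exact payload_of_mem_dummies hm

theorem compStep_isRegular {l : ℕ} (ha : 1 ≤ a) {col : Fin (2 ^ a) → Fin (2 ^ a)} :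
    IsRegular (compStep l col) where
  exists_label := ⟨1, le_rfl, ha, rfl, le_rfl⟩
  src_le r := (card_dummies_src le_rfl ha r).trans one_le_two
  dst_le r := (card_dummies_dst le_rfl ha r).trans one_le_two
  payload_le _ hm := payload_of_mem_dummies hm

theorem steps_isRegular (k : ℕ) : ∀ (l : ℕ) (col : Fin (2 ^ a) → Fin (2 ^ a)), 2 ^ k ≤ a →
    ∀ s ∈ steps k l col, IsRegular s := by
  induction k with
  | zero =>
    intro l col ha s hs
    have ha : 1 ≤ a := by simpa using ha
    rw [steps, List.mem_cons, List.mem_singleton] at hs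
    rcases hs with rfl | rfl
    · exact commStep_isRegular le_rfl ha (flipCol_injective (l := 0) ha)
    · exact compStep_isRegular ha
  | succ k ih =>
    intro l col ha s hs
    have hk := two_mul_two_pow_le ha
    rw [steps, List.mem_append, List.mem_cons] at hs
    rcases hs with hs | rfl | hs
    · exact ih _ _ (by omega) s hs
    · exact commStep_isRegular Nat.one_le_two_pow ha (transpose_bijective hk).1
    · exact ih _ _ (by omega) s hs

theorem alg_isRegular (k : ℕ) : ∀ s ∈ (alg k).steps, IsRegular s :=
  steps_isRegular k 0 id le_rfl

/-- The balance constant `1` is a placeholder: it is trivial on `n` processors and is replaced after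
folding. -/
theorem alg_isFFTAlg (k : ℕ) {κ : ℕ} (hκ : 1 ≤ κ) : IsFFTAlg 1 κ (alg k) where
  valid := alg_valid k
  message_size s hs m hm := ((alg_isRegular k s hs).payload_le m hm).trans hκ
  eval_once v hv := by
    rw [isInputNode_iff] at hv
    refine (steps_evalCount k v 0 id (by simp) isArrangement_id).trans (if_pos ?_)
    have := v.2.isLt
    omega
  input_once v hv := by
    rw [isInputNode_iff] at hv
    exact (sum_count_node (Nat.zero_le _) Function.bijective_id v).trans (if_pos hv)
  balanced r := by
    rw [alg_work, one_mul]
    exact le_mul_of_one_le_left (by positivity) (one_le_pow₀ (by norm_num))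

/-! ## Communication complexity and wiseness -/

theorem degree_fold_le_of_isRegular {e : ℕ} (he : e ≤ a) {s : Superstep (FFTNode a) a}
    (hs : IsRegular s) : (s.fold e).degree ≤ 2 ^ (a - e) * 2 :=
  s.degree_fold_le he hs.src_le hs.dst_le

/-- The first `2 ^ (a - j)` virtual processors all fold onto processor `0`. A charged label means `2
^ b / 2 ≥ 2 ^ (a - j)`, so each of them sends a dummy message, and all these messages leave
processor `0`. -/
theorem le_degree_fold {j : ℕ} (hj : j ≤ a) {s : Superstep (FFTNode a) a} (hs : IsRegular s)
    (hl : s.label < j) : 2 ^ (a - j) ≤ (s.fold j).degree := by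
  obtain ⟨b, hb, hba, hlab, hd⟩ := hs.exists_label
  have h1 := two_pow_half hb
  have h2 : 2 ^ b ≤ 2 ^ a := Nat.pow_le_pow_right (by norm_num) hba
  have h3 : 2 * 2 ^ (a - j) ≤ 2 ^ b := by
    rw [← pow_succ']
    exact Nat.pow_le_pow_right (by norm_num) (by omega)
  have h4 : 0 < 2 ^ (a - j) := by positivity
  refine le_trans ?_ ((s.fold j).sent_le_degree 0)
  have h5 : ((Multiset.range (2 ^ (a - j))).map fun i =>
      (⟨foldPE j (vp i : Fin (2 ^ a)), foldPE j (vp (i + 2 ^ b / 2) : Fin (2 ^ a)), ∅⟩ : Message (FFTNode a) j)) ≤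
      (s.fold j).msgs.filter fun m => m.src = 0 ∧ m.dst ≠ 0 := by
    rw [Multiset.le_filter]
    constructor
    · refine le_trans ?_ (Multiset.map_le_map hd)
      rw [dummies, Multiset.map_map]
      exact Multiset.map_le_map (Multiset.range_le.2 (by omega))
    · intro m hm
      obtain ⟨i, hi, rfl⟩ := Multiset.mem_map.1 hm
      rw [Multiset.mem_range] at hi
      simp only [ne_eq, Fin.ext_iff, foldPE_val hj]
      rw [vp_val (by omega), vp_val (by omega)]
      refine ⟨Nat.div_eq_of_lt hi, ?_⟩
      have : 0 < (i + 2 ^ b / 2) / 2 ^ (a - j) := Nat.div_pos (by omega) h4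
      simp only [Fin.val_zero]
      omega
  have h6 := Multiset.card_le_card h5
  rwa [Multiset.card_map, Multiset.card_range] at h6

/-- Both sides are compared with the number of supersteps of label below `j`: each has degree at
most `2` on `n` processors and at least `2 ^ (a - j)` on `2 ^ j`. -/
theorem alg_isWise (k : ℕ) : (alg k).IsWise (1 / 2) (2 ^ k) := by
  intro j hj hja
  set a := 2 ^ k
  have h1 : ∑ i ∈ Finset.range j, (((alg k).fold a).F i : ℝ) ≤
      2 * ∑ i ∈ Finset.range j, ((alg k).S i : ℝ) := by
    rw [Finset.mul_sum]
    refine Finset.sum_le_sum fun i _ => ?_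
    have := StaticAlg.F_fold_le (e := a) (fun s hs =>
      degree_fold_le_of_isRegular le_rfl (alg_isRegular k s hs)) i
    rw [Nat.sub_self, pow_zero, one_mul, mul_comm] at this
    exact_mod_cast this
  have h2 : 2 ^ (a - j) * ∑ i ∈ Finset.range j, ((alg k).S i : ℝ) ≤
      ∑ i ∈ Finset.range j, (((alg k).fold j).F i : ℝ) := by
    rw [Finset.mul_sum]
    refine Finset.sum_le_sum fun i hi => ?_
    have := StaticAlg.le_F_fold (e := j) (i := i) (B := alg k) (D := 2 ^ (a - j)) fun s hs hl =>
      le_degree_fold hja (alg_isRegular k s hs) (hl.trans_lt (Finset.mem_range.1 hi))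
    rw [mul_comm] at this
    exact_mod_cast this
  have h3 : (2 : ℝ) ^ a / 2 ^ j = 2 ^ (a - j) := by
    rw [pow_sub₀ _ (by norm_num) hja, div_eq_mul_inv]
  rw [h3]
  have h4 := mul_le_mul_of_nonneg_left h1 (show (0 : ℝ) ≤ 2 ^ (a - j) by positivity)
  linarith

/-- With `x` charged supersteps at size exponent `2 ^ k`, the next one has `2x + 1`, so `x + 1`
doubles together with `2 ^ k`. The factor `4` leaves room for the first charged size, where `x = 1`,
and for `e = a`, where both supersteps of the base case are charged. -/
theorem charged_steps_le {e : ℕ} (he : e ≤ a) (k : ℕ) :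
    ∀ (l : ℕ) (col : Fin (2 ^ a) → Fin (2 ^ a)), 2 ^ k ≤ a →
      (2 ^ k ≤ a - e ∧ ((steps k l col).filter fun s => s.label < e).length = 0) ∨
      (a - e < 2 ^ k ∧
        (((steps k l col).filter fun s => s.label < e).length + 1) * max 1 (a - e) ≤ 4 * 2 ^ k) := by
  induction k with
  | zero =>
    intro l col ha
    by_cases h : a - 1 < e
    · right
      have h1 : a - e = 0 := by omega
      simp [steps, commStep, compStep, h, h1]
    · left
      have h1 : 1 ≤ a - e := by simp at ha; omega
      simp [steps, commStep, compStep, h, h1]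
  | succ k ih =>
    intro l col ha
    have hk2 : 2 ^ (k + 1) = 2 ^ k + 2 ^ k := by rw [pow_succ]; omega
    have hk0 : 0 < 2 ^ k := by positivity
    have i1 := ih l col (by omega)
    have i2 := ih (l + 2 ^ k) (arrange k col ∘ transpose (2 ^ 2 ^ k)) (by omega)
    set x := ((steps k l col).filter fun s => s.label < e).length
    set y := ((steps k (l + 2 ^ k) (arrange k col ∘ transpose (2 ^ 2 ^ k))).filter
      fun s => s.label < e).length
    have hxy : ((steps (k + 1) l col).filter fun s => s.label < e).length =
        x + (if a - 2 ^ (k + 1) < e then 1 else 0) + y := by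
      rw [steps, List.filter_append, List.length_append, List.filter_cons]
      by_cases h : a - 2 ^ (k + 1) < e
      · have h' : (commStep (2 ^ (k + 1)) (l + 2 ^ k) (arrange k col)
          (transpose (2 ^ 2 ^ k))).label < e := h
        rw [if_pos (by simpa using h'), if_pos h, List.length_cons]
        omega
      · have h' : ¬ (commStep (2 ^ (k + 1)) (l + 2 ^ k) (arrange k col)
          (transpose (2 ^ 2 ^ k))).label < e := h
        rw [if_neg (by simpa using h'), if_neg h]
        omega
    rw [hxy]
    by_cases h : a - 2 ^ (k + 1) < e
    · right
      rw [if_pos h]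
      refine ⟨by omega, ?_⟩
      rcases i1 with ⟨h1, h2⟩ | ⟨h1, h2⟩
      · rcases i2 with ⟨h3, h4⟩ | ⟨h3, h4⟩
        · rw [h2, h4]; omega
        · omega
      · rcases i2 with ⟨h3, h4⟩ | ⟨h3, h4⟩
        · omega
        · have : (x + 1 + y + 1) * max 1 (a - e) =
            (x + 1) * max 1 (a - e) + (y + 1) * max 1 (a - e) := by ring
          omega
    · left
      rw [if_neg h]
      rcases i1 with ⟨h1, h2⟩ | ⟨h1, h2⟩
      · rcases i2 with ⟨h3, h4⟩ | ⟨h3, h4⟩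
        · omega
        · omega
      · omega

theorem commComplexity_le {k e : ℕ} (he : e ≤ 2 ^ k) {σ : ℝ} (hσ : 0 ≤ σ) :
    ((alg k).fold e).commComplexity σ ≤
      8 * ((2 ^ (2 ^ k - e) + σ) * ((2 ^ k : ℕ) / max 1 ((2 ^ k - e : ℕ) : ℝ))) := by
  set a := 2 ^ k with ha
  have h1 : ((alg k).fold e).commComplexity σ ≤
      ((((alg k).steps.filter fun s => s.label < e).length : ℕ) : ℝ) * (2 ^ (a - e) * 2 + σ) := by
    rw [← StaticAlg.sum_S_eq, Nat.cast_sum, Finset.sum_mul, StaticAlg.commComplexity]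
    refine Finset.sum_le_sum fun i _ => ?_
    rw [StaticAlg.S_fold, mul_add]
    have := StaticAlg.F_fold_le (e := e) (fun s hs =>
      degree_fold_le_of_isRegular he (alg_isRegular k s hs)) i
    have : (((alg k).fold e).F i : ℝ) ≤ (alg k).S i * (2 ^ (a - e) * 2) := by exact_mod_cast this
    linarith
  have hM : (0 : ℝ) < max 1 ((a - e : ℕ) : ℝ) := lt_of_lt_of_le one_pos (le_max_left _ _)
  have h2 : ((((alg k).steps.filter fun s => s.label < e).length : ℕ) : ℝ) ≤
      4 * ((a : ℕ) / max 1 ((a - e : ℕ) : ℝ)) := by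
    rw [← mul_div_assoc, le_div_iff₀ hM]
    have h3 := charged_steps_le he k 0 id le_rfl
    have h4 : ((alg k).steps.filter fun s => s.label < e).length * max 1 (a - e) ≤ 4 * a := by
      rcases h3 with ⟨-, h⟩ | ⟨-, h⟩
      · have : ((alg k).steps.filter fun s => s.label < e).length = 0 := h
        rw [this]; omega
      · exact le_trans (Nat.mul_le_mul_right _ (Nat.le_succ _)) h
    exact_mod_cast h4
  have h5 : (0 : ℝ) ≤ 2 ^ (a - e) := by positivity
  have h6 : (0 : ℝ) ≤ (a : ℕ) / max 1 ((a - e : ℕ) : ℝ) := by positivity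
  calc _ ≤ _ := h1
    _ ≤ 4 * ((a : ℕ) / max 1 ((a - e : ℕ) : ℝ)) * (2 * (2 ^ (a - e) + σ)) := by
      apply mul_le_mul h2 (by linarith) (by positivity) (by positivity)
    _ = _ := by ring

end RecFFT

/-! ### Assembly of the theorem -/

theorem plog_two_pow (x : ℕ) : plog (2 ^ x : ℝ) = max 1 (x : ℝ) := by
  rw [plog, Real.logb_pow, Real.logb_self_eq_one (by norm_num), mul_one]

theorem mainTheorem5 :
    -- communication complexity
    (∃ C : ℝ, 0 < C ∧ ∀ (k e n p : ℕ) (σ : ℝ), n = 2 ^ 2 ^ k → p = 2 ^ e → 1 < p → p ≤ n → 0 ≤ σ →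
      ((RecFFT.alg k).fold e).commComplexity σ
        ≤ C * (((n : ℝ) / p + σ) * (plog n / plog ((n : ℝ) / p)))) ∧
    -- wiseness
    (∃ α : ℝ, 0 < α ∧ α ≤ 1 ∧ ∀ k : ℕ, (RecFFT.alg k).IsWise α (2 ^ k)) ∧
    -- optimality
    (∀ (ε : ℝ) (κ : ℕ) (c : ℝ), 1 / 2 ≤ ε → ε < 1 → 1 ≤ κ → 0 ≤ c →
      ∃ β : ℝ, 0 < β ∧ β ≤ 1 ∧
        ∀ (k e n p : ℕ) (σ : ℝ), n = 2 ^ 2 ^ k → p = 2 ^ e → 1 < p → p ≤ n →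
          0 ≤ σ → σ ≤ c * ((n : ℝ) / p) →
          ((RecFFT.alg k).fold e).IsOptimal β σ (FFTClass ε κ (2 ^ k) e)) := by
  have hp : ∀ k e n p : ℕ, n = 2 ^ 2 ^ k → p = 2 ^ e → 1 < p → p ≤ n → 1 ≤ e ∧ e ≤ 2 ^ k ∧
      (n : ℝ) / p = 2 ^ (2 ^ k - e) ∧ plog n = (2 ^ k : ℕ) ∧
        plog ((n : ℝ) / p) = max 1 ((2 ^ k - e : ℕ) : ℝ) := by
    rintro k e n p rfl rfl h1 h2
    have he : e ≤ 2 ^ k := (Nat.pow_le_pow_iff_right (by norm_num)).1 h2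
    have hq : ((2 ^ 2 ^ k : ℕ) : ℝ) / (2 ^ e : ℕ) = 2 ^ (2 ^ k - e) := by
      push_cast
      rw [pow_sub₀ _ (by norm_num) he, div_eq_mul_inv]
    refine ⟨?_, he, hq, ?_, ?_⟩
    · rcases Nat.eq_zero_or_pos e with rfl | h
      · simp at h1
      · exact h
    · rw [Nat.cast_pow, Nat.cast_ofNat, plog_two_pow]
      exact max_eq_right (by exact_mod_cast Nat.one_le_two_pow)
    · rw [hq, plog_two_pow]
  refine ⟨⟨8, by norm_num, ?_⟩, ⟨1 / 2, by norm_num, by norm_num, RecFFT.alg_isWise⟩, ?_⟩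
  · intro k e n p σ hn hpe h1 h2 hσ
    obtain ⟨-, he, hq, hl, hl'⟩ := hp k e n p hn hpe h1 h2
    rw [hl', hq, hl]
    exact RecFFT.commComplexity_le he hσ
  · intro ε κ c hε hε1 hκ hc
    obtain ⟨δ, hδ, hlow⟩ := StaticAlg.exists_le_commComplexity (ε := ε) (by linarith) hε1 hκ
    -- For `σ ≤ c n/p` the upper bound is `8 (1 + c)` times, and the lower bound `δ` times, the same
    -- quantity `(n/p) log n / log(n/p)`; `β` is the quotient, capped at `1`.
    refine ⟨min 1 (δ / (8 * (1 + c))), lt_min one_pos (by positivity), min_le_left _ _, ?_⟩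
    intro k e n p σ hn hpe h1 h2 hσ hσc
    obtain ⟨he1, he, hq, -, -⟩ := hp k e n p hn hpe h1 h2
    rw [hq] at hσc
    refine ⟨(RecFFT.alg_isFFTAlg k hκ).fold_mem_FFTClass hε he he1
      fun r => (RecFFT.alg_work k r).le, fun B' hB' => ?_⟩
    have e1 := hlow (2 ^ k) e B' σ (by positivity) he hσ hB'.1
    have e2 := RecFFT.commComplexity_le he hσ
    set R : ℝ := (2 ^ k : ℕ) / max 1 ((2 ^ k - e : ℕ) : ℝ)
    have hR : 0 ≤ R := by positivity
    have hm : (0 : ℝ) < 2 ^ (2 ^ k - e) := by positivity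
    have e3 : 8 * ((2 ^ (2 ^ k - e) + σ) * R) ≤ 8 * (1 + c) * (2 ^ (2 ^ k - e) * R) := by
      have : (2 ^ (2 ^ k - e) + σ) * R ≤ ((1 + c) * 2 ^ (2 ^ k - e)) * R := by
        gcongr
        linarith
      linarith
    have e4 : 2 ^ (2 ^ k - e) * R ≤ B'.commComplexity σ / δ := by
      rw [le_div_iff₀ hδ]
      linarith
    have hB0 : 0 ≤ B'.commComplexity σ := le_trans (by positivity) e1
    calc _ ≤ 8 * (1 + c) * (2 ^ (2 ^ k - e) * R) := e2.trans e3
      _ ≤ 8 * (1 + c) * (B'.commComplexity σ / δ) := by gcongr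
      _ = 1 / (δ / (8 * (1 + c))) * B'.commComplexity σ := by field_simp
      _ ≤ _ := by
        gcongr
        exact min_le_right _ _
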